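/- Let $N = n+1 > 2$, and let $C_N$ be the cycle graph with vertices $0,1,\dots,n$ and edges $\{0,1\},\{1,2\},\dots,\{n-1,n\},\{n,0\}$. Let $K$ be a field with a valuation $\operatorname{val}\colon K \to \mathbb{R}\cup\{\infty\}$. Consider the unmixed Kuramoto equations of $C_N$, that is, the Laurent polynomials $$F_k = c_k - \sum_{\{i,j\}\in \mathcal{E}(C_N)} \left( a_{ijk}\,\frac{x_i}{x_j} + a_{jik}\,\frac{x_j}{x_i} \right) \in K[x_1^{\pm1},\dots,x_n^{\pm1}], \qquad k = 1,\dots,n,$$ where $x_0 = 1$ and where $\operatorname{val}(c_k) = 0$ for all $k$ and, for all $k$ and all ordered pairs $(i,j)$ of adjacent vertices, $\operatorname{val}(a_{ijk}) = 2$ if $N$ is even and $\{i,j\} = \{0,1\}$, and $\operatorname{val}(a_{ijk}) = 1$ otherwise. Then the tropicalizations (in the min convention) of $F_1,\dots,F_n$ are one and the same tropical Laurent polynomial $h$, and the tropical hypersurface $V(h) \subset \mathbb{R}^n$, the set of points at which the minimum defining $h$ is attained at least twice, has exactly $N\binom{N-1}{\lfloor (N-1)/2\rfloor}$ stable self-intersection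 points, each of multiplicity one. Here the stable self-intersection multiplicity of $V(h)$ at a point $p$ is the number, counted with multiplicity, of the (transversal) intersection points near $p$ of the translates $V(h)+u_1,\dots,V(h)+u_n$ for sufficiently small generic vectors $u_1,\dots,u_n\in\mathbb{R}^n$, where a transversal intersection point counts with multiplicity $|\det(d_1,\dots,d_n)|$ for the edges $d_1,\dots,d_n\in\mathbb{Z}^n$ of the Newton subdivision of $h$ that are dual to the cells of the $n$ translates in which the point lies. The stable self-intersection points are the points at which this multiplicity is positive. -/

import Mathlib

noncomputable section

/-! ### Laurent polynomials and the Kuramoto equations -/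

/-- Laurent polynomials in `x₁, …, xₙ` over `K` (the variables are indexed by `Fin n`, so that
`xᵢ₊₁` has index `i`); the monomial `x ^ m` is `AddMonoidAlgebra.single m 1`. -/
abbrev LaurentPoly (n : ℕ) (K : Type*) [Semiring K] := AddMonoidAlgebra K (Fin n → ℤ)

/-- The exponent vector of `xᵢ` for `i = 0, …, n`, where `x₀ = 1`: thus `e₀ = 0`, and
`e₁, …, eₙ` are the standard basis vectors of `ℤⁿ`. -/
def vertexExponent {n : ℕ} (i : Fin (n + 1)) : Fin n → ℤ :=
  Fin.cases 0 (fun j => Pi.single j 1) i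

/-- The Laurent monomial `b * xᵢ / xⱼ`. -/
def ratioMonomial {n : ℕ} {K : Type*} [Semiring K] (i j : Fin (n + 1)) (b : K) :
    LaurentPoly n K :=
  AddMonoidAlgebra.single (vertexExponent i - vertexExponent j) b

/-- The synchronization equation
`F_{G,i} = cᵢ - ∑_{j ∈ N_G(i)} (aᵢⱼ xᵢ / xⱼ - bᵢⱼ xⱼ / xᵢ)`, for `i = 1, …, n`
(the vertex `i` is written `i.succ` with `i : Fin n`). -/
def syncEquation {n : ℕ} {K : Type*} [Ring K] (G : SimpleGraph (Fin (n + 1)))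
    [DecidableRel G.Adj] (c : Fin n → K) (a b : Fin (n + 1) → Fin (n + 1) → K) (i : Fin n) :
    LaurentPoly n K :=
  AddMonoidAlgebra.single 0 (c i) -
    ∑ j with G.Adj i.succ j,
      (ratioMonomial i.succ j (a i.succ j) - ratioMonomial j i.succ (b i.succ j))

/-- The `k`-th equation of the unmixed form of the Kuramoto equations on the graph `G`:
`c_k - ∑_{{i,j} ∈ E(G)} (a_{ijk} xᵢ / xⱼ + a_{jik} xⱼ / xᵢ)`.
The sum is written over the ordered pairs `(i, j)` of adjacent vertices. -/
def unmixedEquation {n : ℕ} {K : Type*} [Ring K] (G : SimpleGraph (Fin (n + 1)))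
    [DecidableRel G.Adj] (c : Fin n → K) (a : Fin (n + 1) → Fin (n + 1) → Fin n → K)
    (k : Fin n) : LaurentPoly n K :=
  AddMonoidAlgebra.single 0 (c k) - ∑ i, ∑ j with G.Adj i j, ratioMonomial i j (a i j k)

/-- The coefficients of the system `R · F_G` after the collection of similar terms. -/
def collectedCoeff {n : ℕ} {K : Type*} [Ring K] (R : Matrix (Fin n) (Fin n) K)
    (a b : Fin (n + 1) → Fin (n + 1) → K) (i j : Fin (n + 1)) (k : Fin n) : K :=
  Fin.cases 0 (fun l => R k l) i * a i j - Fin.cases 0 (fun l => R k l) j * b j i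

/-- The system `R · F_G` is of the unmixed form. -/
theorem randomized_sync_eq_unmixed {n : ℕ} {K : Type*} [Ring K]
    (G : SimpleGraph (Fin (n + 1))) [DecidableRel G.Adj] (R : Matrix (Fin n) (Fin n) K)
    (c : Fin n → K) (a b : Fin (n + 1) → Fin (n + 1) → K) (k : Fin n) :
    ∑ i, R k i • syncEquation G c a b i =
      unmixedEquation G (R.mulVec c) (collectedCoeff R a b) k := by
  have hsub : ∀ (i j : Fin (n + 1)) (x y : K),
      (ratioMonomial i j (x - y) : LaurentPoly n K)
        = ratioMonomial i j x - ratioMonomial i j y := fun i j x y => by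
    simp [ratioMonomial]
  have hsmul : ∀ (i j : Fin (n + 1)) (r x : K),
      r • (ratioMonomial i j x : LaurentPoly n K) = ratioMonomial i j (r * x) :=
    fun i j r x => by simp [ratioMonomial]
  have hzero : ∀ (i j : Fin (n + 1)), (ratioMonomial i j 0 : LaurentPoly n K) = 0 :=
    fun i j => by simp [ratioMonomial]
  have hconst : (AddMonoidAlgebra.single 0 (R.mulVec c k) : LaurentPoly n K)
      = ∑ i, R k i • AddMonoidAlgebra.single 0 (c i) := by
    simp only [Matrix.mulVec, dotProduct, AddMonoidAlgebra.smul_single, smul_eq_mul]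
    exact map_sum (AddMonoidAlgebra.singleAddHom (0 : Fin n → ℤ)) _ _
  unfold unmixedEquation syncEquation collectedCoeff
  simp only [hsub, smul_sub, Finset.sum_sub_distrib, hconst, Finset.smul_sum, hsmul]
  congr 1
  congr 1
  · rw [Fin.sum_univ_succ]
    simp [hzero]
  · simp only [Finset.sum_filter]
    conv_rhs => rw [Finset.sum_comm, Fin.sum_univ_succ]
    simp [hzero, G.adj_comm]

/-! ### Tropicalization and tropical hypersurfaces (min convention) -/

/-- Tropical Laurent polynomials in `n` variables, with coefficients in the tropical (min-plus)
semiring `ℝ ∪ {∞}`. -/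
abbrev TropicalLaurentPoly (n : ℕ) := LaurentPoly n (Tropical (WithTop ℝ))

/-- The tropicalization of a Laurent polynomial over a valued field: every coefficient is
replaced by its valuation. -/
def tropicalize {n : ℕ} {K : Type*} [Field K] (v : AddValuation K (WithTop ℝ))
    (F : LaurentPoly n K) : TropicalLaurentPoly n :=
  .ofCoeff (F.coeff.mapRange (fun x => Tropical.trop (v x)) (by simp))

/-- The value `h_m + ⟨m, w⟩` at `w` of the term of exponent `m` of `h`. -/
def tropicalTerm {n : ℕ} (h : TropicalLaurentPoly n) (m : Fin n → ℤ) (w : Fin n → ℝ) :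
    WithTop ℝ :=
  Tropical.untrop (h.coeff m) + ((∑ i, (m i : ℝ) * w i : ℝ) : WithTop ℝ)

/-- The exponents of the terms of `h` at which the minimum `h(w)` is attained. -/
def activeExponents {n : ℕ} (h : TropicalLaurentPoly n) (w : Fin n → ℝ) : Set (Fin n → ℤ) :=
  {m | m ∈ h.coeff.support ∧
    ∀ m' ∈ h.coeff.support, tropicalTerm h m w ≤ tropicalTerm h m' w}

/-- The tropical hypersurface of `h`: the points at which the minimum is attained at least
twice. -/
def tropicalHypersurface {n : ℕ} (h : TropicalLaurentPoly n) : Set (Fin n → ℝ) :=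
  {w | (activeExponents h w).Nontrivial}

/-! ### Stable intersections and their multiplicities -/

/-- The cell of the Newton subdivision of `h` dual to `w` is a segment, and `d` is the difference
of its end points. Then `w` is a smooth point of the hypersurface, which is orthogonal to `d` near
`w` and has there as its weight the lattice length of `d`. -/
def IsDualEdge {n : ℕ} (h : TropicalLaurentPoly n) (w : Fin n → ℝ) (d : Fin n → ℤ) : Prop :=
  ∃ p ∈ activeExponents h w, ∃ q ∈ activeExponents h w, p ≠ q ∧ d = q - p ∧
    ∀ m ∈ activeExponents h w,
      (fun i => (m i : ℝ)) ∈ segment ℝ (fun i => (p i : ℝ)) (fun i => (q i : ℝ))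

/-- The hypersurface of `h` translated by the vector `u`. -/
def translatedHypersurface {n : ℕ} (h : TropicalLaurentPoly n) (u : Fin n → ℝ) :
    Set (Fin n → ℝ) :=
  {w | w - u ∈ tropicalHypersurface h}

/-- The translated hypersurfaces `V(h₁) + u₁, …, V(hₙ) + uₙ` meet transversally at `w`, with
intersection multiplicity `μ`. The multiplicity is the product of the `n` weights and of the index
in `ℤⁿ` of the sublattice spanned by the primitive normal vectors, that is, `|det (d₁, …, dₙ)|`
for the dual edges `dᵢ`. -/
def MeetsTransversally {n : ℕ} (h : Fin n → TropicalLaurentPoly n) (u : Fin n → Fin n → ℝ)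
    (w : Fin n → ℝ) (μ : ℕ) : Prop :=
  ∃ d : Matrix (Fin n) (Fin n) ℤ,
    (∀ i, IsDualEdge (h i) (w - u i) (d i)) ∧ d.det ≠ 0 ∧ μ = d.det.natAbs

/-- The stable intersection of the hypersurfaces of `h₁, …, hₙ` in `ℝⁿ` has multiplicity `m` at
`p`: if the hypersurfaces are translated by small generic vectors `u₁, …, uₙ`, then near `p` the
translates meet in finitely many points, transversally, and the multiplicities of these points add
up to `m`. A tuple of vectors is generic if it avoids the zero sets of finitely many given nonzero
linear functionals. -/
def HasStableMultiplicity {n : ℕ} (h : Fin n → TropicalLaurentPoly n) (p : Fin n → ℝ) (m : ℕ) :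
    Prop :=
  ∃ L : Finset ((Fin n → Fin n → ℝ) →ₗ[ℝ] ℝ), (∀ l ∈ L, l ≠ 0) ∧
    ∀ᶠ r in nhdsWithin (0 : ℝ) (Set.Ioi 0), ∀ᶠ u in nhds (0 : Fin n → Fin n → ℝ),
      (∀ l ∈ L, l u ≠ 0) →
        ∃ (s : Finset (Fin n → ℝ)) (μ : (Fin n → ℝ) → ℕ),
          (s : Set (Fin n → ℝ)) =
            Metric.ball p r ∩ ⋂ i, translatedHypersurface (h i) (u i) ∧
          (∀ w ∈ s, MeetsTransversally h u w (μ w)) ∧ ∑ w ∈ s, μ w = m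

/-- The stable self-intersection points of the tropical hypersurface of `h` in `ℝⁿ`: the points of
the stable intersection of `n` copies of it. -/
def stableSelfIntersection {n : ℕ} (h : TropicalLaurentPoly n) : Set (Fin n → ℝ) :=
  {p | ∃ m, 0 < m ∧ HasStableMultiplicity (fun _ : Fin n => h) p m}

/-! ### The weights -/

/-- The valuation of the coefficients `a_{ijk}` for the cycle on the `N = n + 1` vertices
`0, …, n`: it is `2` on the edge `{1, 0}` if `N` is even, and `1` otherwise. -/
def cycleWeight (n : ℕ) (i j : Fin (n + 1)) : WithTop ℝ :=
  if Even (n + 1) ∧ s(i, j) = s(1, 0) then 2 else 1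

end

/-!
Write `y_e = w_{e+1} - w_e` for the slopes of a point `w ∈ ℝⁿ` along the edges of the cycle, where
`w₀ = 0`. The slopes sum up to zero, and otherwise they are arbitrary. All the equations have the
tropicalization `h(w) = min(0, C_e ± y_e)`, where `C_e` is the weight of the edge `e`.

The weights are such that `∑ ± (C_e + t) ≠ 0` for all signs and all `t ≥ 0`
(`signed_sum_edgeWeight_ne_zero`). Hence the exponents active at a point `p` affinely span `ℝⁿ` only
if the constant term is active and exactly one edge `k` is slack: `|y_e| = C_e` for `e ≠ k` and
`|y_k| < C_k`. These points are the elements of `cycleVertices`. Any `n` of the edge vectors form a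
basis of `ℤⁿ`, because a regular matrix whose rows are edges of the standard simplex is unimodular
(`natAbs_det_simplex_edges_le`). So at such a point the active exponents are the vertices of a
unimodular simplex.

The stable multiplicities follow from a local analysis. Near `p` the hypersurface is the one of the
active terms at `p`. For translations off finitely many hyperplanes, edges that are tight at a
common point are linearly independent (`exists_generic_functionals`). If the active exponents do not
span, then there is thus no common point (`hasStableMultiplicity_zero`). If they are the vertices
of a unimodular simplex, then integral coordinates turn the translates into tropical hyperplanes
(`hasStableMultiplicity_one`). These have a common point, by the tropical Cramer rule
(`minAttainedTwice_add_tropicalMinor`), and it depends continuously on the translations. Two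
distinct common points would yield dependent tight edges (`exists_degenerate_edges`). The
multiplicity is one by unimodularity.

It remains to count the elements of `cycleVertices`, that is, the pairs of an edge `k` and a choice
of signs on the other edges with a signed sum of weights of absolute value less than `C_k`
(`ncard_cycleVertices_eq`).
-/

/-! ### Intersections of tropical hyperplanes -/

/-- The minimum of the finite family `a` is attained at least twice. -/
def MinAttainedTwice {κ : Type*} (a : κ → ℝ) : Prop :=
  ∃ i i', i ≠ i' ∧ (∀ k, a i ≤ a k) ∧ ∀ k, a i' ≤ a k

/-- The tropical maximal minor of the `ι × Option ι` matrix `A` obtained by deletion of the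
column `i`. A bijection from the rows to the remaining columns is encoded as a permutation of
`Option ι` that sends `none` to `i`. -/
noncomputable def tropicalMinor {ι : Type*} [Fintype ι] [DecidableEq ι] (A : ι → Option ι → ℝ)
    (i : Option ι) : ℝ :=
  (Finset.univ.filter fun σ : Equiv.Perm (Option ι) => σ none = i).inf'
    ⟨Equiv.swap none i, by simp⟩ fun σ => ∑ j, A j (σ (some j))

section Cramer

variable {ι : Type*} [Fintype ι] [DecidableEq ι]

theorem tropicalMinor_le (A : ι → Option ι → ℝ) (σ : Equiv.Perm (Option ι)) :
    tropicalMinor A (σ none) ≤ ∑ j, A j (σ (some j)) :=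
  Finset.inf'_le (fun σ : Equiv.Perm (Option ι) => ∑ j, A j (σ (some j))) (by simp)

theorem exists_tropicalMinor_eq (A : ι → Option ι → ℝ) (i : Option ι) :
    ∃ σ : Equiv.Perm (Option ι), σ none = i ∧ tropicalMinor A i = ∑ j, A j (σ (some j)) := by
  obtain ⟨σ, hσ, h⟩ := Finset.exists_mem_eq_inf'
    (s := Finset.univ.filter fun σ : Equiv.Perm (Option ι) => σ none = i)
    ⟨Equiv.swap none i, by simp⟩ fun σ => ∑ j, A j (σ (some j))
  exact ⟨σ, by simpa using hσ, h⟩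

theorem continuous_tropicalMinor (i : Option ι) :
    Continuous fun A : ι → Option ι → ℝ => tropicalMinor A i := by
  unfold tropicalMinor
  refine Continuous.finset_inf'_apply _ fun σ _ => ?_
  fun_prop

theorem tropicalMinor_zero (i : Option ι) :
    tropicalMinor (0 : ι → Option ι → ℝ) i = 0 := by
  obtain ⟨σ, -, h⟩ := exists_tropicalMinor_eq (0 : ι → Option ι → ℝ) i
  simpa using h

/-- The tropical Cramer rule: the vector of tropical maximal minors lies on all the tropical
hyperplanes given by the rows. The reason is the vanishing of the determinant of the square matrix
with the row `r` repeated: an exchange of the two equal rows does not change the value of an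
optimal permutation. -/
theorem minAttainedTwice_add_tropicalMinor (A : ι → Option ι → ℝ) (r : ι) :
    MinAttainedTwice fun i => A r i + tropicalMinor A i := by
  let F : Equiv.Perm (Option ι) → ℝ := fun σ => A r (σ none) + ∑ j, A j (σ (some j))
  obtain ⟨σ, hσ⟩ := Finite.exists_min F
  have key : ∀ τ, F τ = F σ → ∀ k,
      A r (τ none) + tropicalMinor A (τ none) ≤ A r k + tropicalMinor A k := by
    intro τ hτ k
    obtain ⟨ρ, hk, hρ⟩ := exists_tropicalMinor_eq A k
    have h1 := tropicalMinor_le A τ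
    have h2 := hσ ρ
    simp only [F] at h2 hτ
    rw [hk] at h2
    linarith
  refine ⟨σ none, σ (some r), by simp, key σ rfl, ?_⟩
  have hswap : F (σ * Equiv.swap none (some r)) = F σ := by
    simp only [F, Equiv.Perm.mul_apply, Equiv.swap_apply_left]
    rw [← Finset.add_sum_erase _ _ (Finset.mem_univ r),
      ← Finset.add_sum_erase _ (fun j => A j (σ (some j))) (Finset.mem_univ r),
      Equiv.swap_apply_right]
    have : ∀ j ∈ Finset.univ.erase r,
        A j (σ (Equiv.swap none (some r) (some j))) = A j (σ (some j)) := by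
      intro j hj
      rw [Equiv.swap_apply_of_ne_of_ne (by simp) (by simpa using Finset.ne_of_mem_erase hj)]
    rw [Finset.sum_congr rfl this]
    ring
  simpa using key _ hswap

end Cramer

/-- If the tropical hyperplanes given by the rows of `A` have two distinct common points, then each
of them contains an edge `{p j, q j}` such that these edges neither are independent (the nonzero
vector `z` is constant along all of them) nor impose incompatible conditions (they are all tight at
one vector `g`). The vector `z` is the indicator function of the set of coordinates where the
difference of the two points is minimal, and `g` is glued from the two points along this set. -/
theorem exists_degenerate_edges {ι : Type*} [Finite ι] {A : ι → Option ι → ℝ} {x x' : Option ι → ℝ}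
    (hx : x none = 0) (hx' : x' none = 0)
    (h : ∀ j, MinAttainedTwice fun i => A j i + x i)
    (h' : ∀ j, MinAttainedTwice fun i => A j i + x' i) (hne : x ≠ x') :
    ∃ (p q : ι → Option ι) (g z : Option ι → ℝ), (∀ j, p j ≠ q j) ∧
      (∀ j, A j (p j) + g (p j) = A j (q j) + g (q j)) ∧ (∀ j, z (p j) = z (q j)) ∧
      g none = 0 ∧ z none = 0 ∧ z ≠ 0 := by
  classical
  obtain ⟨i₀, hi₀⟩ := Finite.exists_min fun i => x' i - x i
  let I : Option ι → Prop := fun i => x' i - x i = x' i₀ - x i₀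
  let g : Option ι → ℝ := fun i => if I i then x' i else x i
  let z : Option ι → ℝ := fun i => (if I i then 1 else 0) - if I none then 1 else 0
  have row : ∀ j, ∃ p q, p ≠ q ∧ A j p + g p = A j q + g q ∧ z p = z q := by
    intro j
    obtain ⟨i, i', hii, hi, hi'⟩ := h j
    have inside : (∃ k, I k ∧ ∀ l, A j k + x k ≤ A j l + x l) →
        ∃ p q, p ≠ q ∧ A j p + g p = A j q + g q ∧ z p = z q := by
      rintro ⟨k, hk, hmin⟩
      obtain ⟨p, q, hpq, hp, hq⟩ := h' j
      have mem : ∀ l, (∀ m, A j l + x' l ≤ A j m + x' m) → I l := by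
        intro l hl
        have h1 := hl k
        have h2 := hmin l
        have h3 := hi₀ l
        simp only [I] at hk ⊢
        linarith
      refine ⟨p, q, hpq, ?_, ?_⟩
      · simp only [g, if_pos (mem p hp), if_pos (mem q hq)]
        exact le_antisymm (hp q) (hq p)
      · simp only [z, if_pos (mem p hp), if_pos (mem q hq)]
    by_cases h1 : I i
    · exact inside ⟨i, h1, hi⟩
    by_cases h2 : I i'
    · exact inside ⟨i', h2, hi'⟩
    refine ⟨i, i', hii, ?_, ?_⟩
    · simp only [g, if_neg h1, if_neg h2]
      exact le_antisymm (hi i') (hi' i)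
    · simp only [z, if_neg h1, if_neg h2]
  choose p q hpq hg hz using row
  refine ⟨p, q, g, z, hpq, hg, hz, ?_, by simp [z], ?_⟩
  · simp only [g]; split_ifs <;> assumption
  · intro hz0
    have hall : ∀ i, I i ↔ I none := by
      intro i
      have := congrFun hz0 i
      by_cases h1 : I i <;> by_cases h2 : I none <;> simp [z, h1, h2] at this ⊢
    apply hne
    have h0 : I none := (hall i₀).1 rfl
    funext i
    have h1 := (hall i).2 h0
    simp only [I] at h0 h1
    linarith

/-! ### Unimodularity of edge vectors -/

/-- The vertices of the standard simplex: the origin and the unit vectors. -/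
def simplexVertex {n : ℕ} (o : Option (Fin n)) : Fin n → ℤ :=
  o.elim 0 fun i => Pi.single i 1

theorem vertexExponent_eq_simplexVertex {n : ℕ} (i : Fin (n + 1)) :
    (vertexExponent i : Fin n → ℤ) = simplexVertex (finSuccEquiv n i) := by
  refine Fin.cases ?_ (fun j => ?_) i <;> simp [vertexExponent, simplexVertex]

/-- Deletion of a coordinate maps the vertices of the standard simplex to such vertices. -/
theorem exists_simplexVertex_comp_succAbove {n : ℕ} (c : Fin (n + 1)) (o : Option (Fin (n + 1))) :
    ∃ o' : Option (Fin n), ∀ i, simplexVertex o (c.succAbove i) = simplexVertex o' i := by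
  rcases o with _ | j
  · exact ⟨none, fun i => rfl⟩
  · by_cases hj : j = c
    · refine ⟨none, fun i => ?_⟩
      simp [simplexVertex, hj, Fin.succAbove_ne]
    · obtain ⟨k, rfl⟩ := Fin.exists_succAbove_eq hj
      refine ⟨some k, fun i => ?_⟩
      simp [simplexVertex, Pi.single_apply]

/-- A matrix whose rows are edges of the standard simplex is, if regular, unimodular: it is the
incidence matrix of a directed graph with one vertex removed. -/
theorem natAbs_det_simplex_edges_le {n : ℕ} (M : Matrix (Fin n) (Fin n) ℤ)
    (hM : ∀ j, ∃ p q, M j = simplexVertex q - simplexVertex p) : M.det.natAbs ≤ 1 := by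
  induction n with
  | zero => simp
  | succ n ih =>
    have minor : ∀ j c : Fin (n + 1), (M.submatrix j.succAbove c.succAbove).det.natAbs ≤ 1 := by
      intro j c
      apply ih
      intro k
      obtain ⟨p, q, h⟩ := hM (j.succAbove k)
      obtain ⟨p', hp⟩ := exists_simplexVertex_comp_succAbove c p
      obtain ⟨q', hq⟩ := exists_simplexVertex_comp_succAbove c q
      refine ⟨p', q', ?_⟩
      funext i
      simp [h, hp, hq]
    -- A row with a single nonzero entry: Laplace expansion along it.
    have expand : ∀ j c, (∀ i, i ≠ c → M j i = 0) → (M j c).natAbs = 1 → M.det.natAbs ≤ 1 := by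
      intro j c h0 h1
      rw [Matrix.det_succ_row M j, Finset.sum_eq_single c]
      · rw [Int.natAbs_mul, Int.natAbs_mul, h1, Int.natAbs_pow]
        simpa using minor j c
      · intro i _ hi
        simp [h0 i hi]
      · simp
    by_cases hex : ∃ j, ∃ c, (∀ i, i ≠ c → M j i = 0) ∧ (M j c).natAbs = 1
    · obtain ⟨j, c, h0, h1⟩ := hex
      exact expand j c h0 h1
    -- Otherwise all row sums vanish.
    · have hdet : M.det = 0 := by
        refine Matrix.exists_mulVec_eq_zero_iff.1 ⟨fun _ => 1, ?_, ?_⟩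
        · intro h
          simpa using congrFun h 0
        · funext j
          obtain ⟨p, q, h⟩ := hM j
          have hsum : ∑ i, (simplexVertex q i - simplexVertex p i) = 0 := by
            rcases p with _ | p <;> rcases q with _ | q
            · simp
            · refine absurd ⟨j, q, fun i hi => ?_, ?_⟩ hex <;> simp_all [simplexVertex]
            · refine absurd ⟨j, p, fun i hi => ?_, ?_⟩ hex <;> simp_all [simplexVertex]
            · simp [simplexVertex]
          simpa [Matrix.mulVec, dotProduct, h] using hsum
      simp [hdet]

/-- The edges of a unimodular simplex `0, b₁, …, bₙ` span a sublattice of index one, or else they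
are linearly dependent. -/
theorem natAbs_det_unimodular_edges {n : ℕ} {b : Matrix (Fin n) (Fin n) ℤ} (hb : IsUnit b.det)
    (p q : Fin n → Option (Fin n))
    (h : (Matrix.of fun j => (q j).elim 0 b - (p j).elim 0 b).det ≠ 0) :
    (Matrix.of fun j => (q j).elim 0 b - (p j).elim 0 b).det.natAbs = 1 := by
  have hv : ∀ o : Option (Fin n), Matrix.vecMul (simplexVertex o) b = o.elim 0 b := by
    rintro (_ | o)
    · exact Matrix.zero_vecMul b
    · exact Matrix.single_one_vecMul o b
  have hmul : (Matrix.of fun j => (q j).elim 0 b - (p j).elim 0 b) =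
      (Matrix.of fun j => simplexVertex (q j) - simplexVertex (p j)) * b := by
    funext j
    rw [Matrix.mul_apply_eq_vecMul]
    change (q j).elim 0 b - (p j).elim 0 b =
      Matrix.vecMul (simplexVertex (q j) - simplexVertex (p j)) b
    rw [Matrix.sub_vecMul, hv, hv]
  rw [hmul, Matrix.det_mul] at h ⊢
  rw [Int.natAbs_mul, Int.isUnit_iff_natAbs_eq.1 hb, mul_one]
  have h1 := natAbs_det_simplex_edges_le
    (Matrix.of fun j => simplexVertex (q j) - simplexVertex (p j)) fun j => ⟨p j, q j, rfl⟩
  have h2 := Int.natAbs_ne_zero.2 (left_ne_zero_of_mul h)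
  omega

/-! ### Local structure of tropical hypersurfaces -/

/-- The pairing of the exponent vector `m` with the point `w`. -/
def pairing {n : ℕ} (m : Fin n → ℤ) (w : Fin n → ℝ) : ℝ := ∑ i, (m i : ℝ) * w i

section Pairing

variable {n : ℕ}

theorem pairing_add (m : Fin n → ℤ) (w w' : Fin n → ℝ) :
    pairing m (w + w') = pairing m w + pairing m w' := by
  simp [pairing, mul_add, Finset.sum_add_distrib]

theorem pairing_sub (m : Fin n → ℤ) (w w' : Fin n → ℝ) :
    pairing m (w - w') = pairing m w - pairing m w' := by
  simp [pairing, mul_sub]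

theorem sub_pairing (m m' : Fin n → ℤ) (w : Fin n → ℝ) :
    pairing (m - m') w = pairing m w - pairing m' w := by
  simp [pairing, sub_mul]

theorem zero_pairing (w : Fin n → ℝ) : pairing 0 w = 0 := by simp [pairing]

theorem pairing_zero (m : Fin n → ℤ) : pairing m 0 = 0 := by simp [pairing]

theorem neg_pairing (m : Fin n → ℤ) (w : Fin n → ℝ) : pairing (-m) w = -pairing m w := by
  simp [pairing]

theorem continuous_pairing (m : Fin n → ℤ) : Continuous (pairing m) := by
  unfold pairing; fun_prop

/-- Linear dependence of integral vectors is detected by a common real zero. -/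
theorem det_eq_zero_of_pairing_eq_zero (d : Matrix (Fin n) (Fin n) ℤ) {z : Fin n → ℝ} (hz : z ≠ 0)
    (h : ∀ j, pairing (d j) z = 0) : d.det = 0 := by
  have : (d.map (Int.castRingHom ℝ)).det = 0 :=
    Matrix.exists_mulVec_eq_zero_iff.1 ⟨z, hz, funext fun j => by
      simpa [Matrix.mulVec, dotProduct, pairing] using h j⟩
  rw [← Int.cast_inj (α := ℝ)]
  simpa [Int.cast_det, RingHom.mapMatrix_apply] using this

theorem det_ne_zero_of_forall_pairing (d : Matrix (Fin n) (Fin n) ℤ)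
    (h : ∀ z, (∀ j, pairing (d j) z = 0) → z = 0) : d.det ≠ 0 := by
  intro hd
  have hd' : (d.map (Int.castRingHom ℝ)).det = 0 := by
    have := congrArg (Int.cast : ℤ → ℝ) hd
    simpa [Int.cast_det, RingHom.mapMatrix_apply] using this
  obtain ⟨z, hz, hz'⟩ := Matrix.exists_mulVec_eq_zero_iff.2 hd'
  refine hz (h z fun j => ?_)
  simpa [Matrix.mulVec, dotProduct, pairing] using congrFun hz' j

theorem exists_pairing_eq {d : Matrix (Fin n) (Fin n) ℤ} (hd : d.det ≠ 0) (y : Fin n → ℝ) :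
    ∃ z, ∀ j, pairing (d j) z = y j := by
  have hd' : IsUnit (d.map (Int.castRingHom ℝ)).det := by
    have : (d.map (Int.castRingHom ℝ)).det = Int.castRingHom ℝ d.det :=
      (RingHom.map_det (Int.castRingHom ℝ) d).symm
    rw [this, isUnit_iff_ne_zero]
    simpa using hd
  refine ⟨(d.map (Int.castRingHom ℝ))⁻¹.mulVec y, fun j => ?_⟩
  have : (d.map (Int.castRingHom ℝ)).mulVec ((d.map (Int.castRingHom ℝ))⁻¹.mulVec y) = y := by
    rw [Matrix.mulVec_mulVec, Matrix.mul_nonsing_inv _ hd', Matrix.one_mulVec]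
  simpa [Matrix.mulVec, dotProduct, pairing] using congrFun this j

end Pairing

/-- The value at `w` of the affine function that belongs to the term of exponent `m` of `h`; it is
meaningful for exponents in the support of `h`. -/
noncomputable def termValue {n : ℕ} (h : TropicalLaurentPoly n) (m : Fin n → ℤ) (w : Fin n → ℝ) :
    ℝ :=
  (Tropical.untrop (h.coeff m)).untopD 0 + pairing m w

section Local

variable {n : ℕ} {h : TropicalLaurentPoly n}

theorem tropicalTerm_eq_termValue {m : Fin n → ℤ} (hm : m ∈ h.coeff.support) (w : Fin n → ℝ) :
    tropicalTerm h m w = (termValue h m w : ℝ) := by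
  have hne : Tropical.untrop (h.coeff m) ≠ ⊤ := fun h0 =>
    Finsupp.mem_support_iff.1 hm (Tropical.untrop_injective h0)
  obtain ⟨x, hx⟩ := WithTop.ne_top_iff_exists.1 hne
  simp [tropicalTerm, termValue, ← hx, pairing]

theorem mem_activeExponents {m : Fin n → ℤ} {w : Fin n → ℝ} :
    m ∈ activeExponents h w ↔ m ∈ h.coeff.support ∧
      ∀ m' ∈ h.coeff.support, termValue h m w ≤ termValue h m' w := by
  refine and_congr_right fun hm => forall₂_congr fun m' hm' => ?_
  rw [tropicalTerm_eq_termValue hm, tropicalTerm_eq_termValue hm', WithTop.coe_le_coe]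

theorem termValue_eq_add (h : TropicalLaurentPoly n) (m : Fin n → ℤ) (p w : Fin n → ℝ) :
    termValue h m w = termValue h m p + pairing m (w - p) := by
  rw [termValue, termValue, pairing_sub]; ring

theorem termValue_eq_of_active {p : Fin n → ℝ} {m m' : Fin n → ℤ} (hm : m ∈ activeExponents h p)
    (hm' : m' ∈ activeExponents h p) : termValue h m p = termValue h m' p :=
  le_antisymm ((mem_activeExponents.1 hm).2 m' (mem_activeExponents.1 hm').1)
    ((mem_activeExponents.1 hm').2 m (mem_activeExponents.1 hm).1)

/-- Near `p` a tropical hypersurface is the one of its initial form at `p`, whose exponents are the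
ones active at `p` and whose coefficients are all equal. -/
theorem eventually_mem_activeExponents_iff (h : TropicalLaurentPoly n) (p : Fin n → ℝ) :
    ∀ᶠ w in nhds p, ∀ m, m ∈ activeExponents h w ↔
      m ∈ activeExponents h p ∧
        ∀ m' ∈ activeExponents h p, pairing m (w - p) ≤ pairing m' (w - p) := by
  have hlt : ∀ᶠ w in nhds p, ∀ m ∈ h.coeff.support, ∀ m' ∈ h.coeff.support,
      termValue h m' p < termValue h m p → termValue h m' w < termValue h m w := by
    simp only [Finset.eventually_all]
    intro m _ m' _
    by_cases hlt : termValue h m' p < termValue h m p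
    · have hc : ∀ m, Continuous fun w => termValue h m w := fun m =>
        continuous_const.add (continuous_pairing m)
      filter_upwards [(hc m').continuousAt.eventually_lt (hc m).continuousAt hlt] with w hw _
      exact hw
    · exact Filter.Eventually.of_forall fun w hw => absurd hw hlt
  filter_upwards [hlt] with w hw m
  have hsub : ∀ m ∈ activeExponents h w, m ∈ activeExponents h p := by
    intro m hm
    rw [mem_activeExponents] at hm ⊢
    refine ⟨hm.1, fun m' hm' => ?_⟩
    by_contra hcon
    exact absurd (hm.2 m' hm') (not_le.2 (hw m hm.1 m' hm' (not_le.1 hcon)))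
  constructor
  · intro hm
    refine ⟨hsub m hm, fun m' hm' => ?_⟩
    have h1 := (mem_activeExponents.1 hm).2 m' (mem_activeExponents.1 hm').1
    rw [termValue_eq_add h m p w, termValue_eq_add h m' p w,
      termValue_eq_of_active (hsub m hm) hm'] at h1
    linarith
  · rintro ⟨hm, hmin⟩
    refine mem_activeExponents.2 ⟨(mem_activeExponents.1 hm).1, fun m' hm' => ?_⟩
    obtain ⟨m₀, hm₀, hmin₀⟩ := Finset.exists_min_image h.coeff.support (fun m => termValue h m w)
      ⟨m', hm'⟩
    have hp := hsub m₀ (mem_activeExponents.2 ⟨hm₀, hmin₀⟩)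
    have h1 := hmin m₀ hp
    have h2 := termValue_eq_of_active hm hp
    have h3 := hmin₀ m' hm'
    rw [termValue_eq_add h m₀ p w] at h3
    rw [termValue_eq_add h m p w]
    linarith

end Local

/-! ### Generic translations -/

section Generic

variable {n : ℕ}

/-- If the integral vectors `dⱼ` are nonzero and linearly dependent, then for `u` off the kernel of
a suitable nonzero functional the equations `⟨dⱼ, w - uⱼ⟩ = 0` have no common solution `w`. -/
theorem exists_functional_of_det_eq_zero (d : Matrix (Fin n) (Fin n) ℤ) (hd : d.det = 0)
    (h0 : ∀ j, d j ≠ 0) :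
    ∃ l : (Fin n → Fin n → ℝ) →ₗ[ℝ] ℝ, l ≠ 0 ∧
      ∀ u, l u ≠ 0 → ∀ w, ¬ ∀ j, pairing (d j) (w - u j) = 0 := by
  have hd' : (d.map (Int.castRingHom ℝ)).det = 0 := by
    have := congrArg (Int.cast : ℤ → ℝ) hd
    simpa [Int.cast_det, RingHom.mapMatrix_apply] using this
  obtain ⟨c, hc0, hc⟩ := Matrix.exists_vecMul_eq_zero_iff.2 hd'
  have hcol : ∀ i, ∑ j, c j * (d j i : ℝ) = 0 := fun i => by
    simpa [Matrix.vecMul, dotProduct] using congrFun hc i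
  let l : (Fin n → Fin n → ℝ) →ₗ[ℝ] ℝ :=
    { toFun := fun u => ∑ j, c j * pairing (d j) (u j)
      map_add' := fun u u' => by simp [pairing_add, mul_add, Finset.sum_add_distrib]
      map_smul' := fun t u => by
        simp only [pairing, Finset.mul_sum, Pi.smul_apply, smul_eq_mul, RingHom.id_apply]
        refine Finset.sum_congr rfl fun j _ => Finset.sum_congr rfl fun i _ => ?_
        ring }
  refine ⟨l, ?_, ?_⟩
  · intro hl
    obtain ⟨k, hk⟩ := Function.ne_iff.1 hc0
    obtain ⟨i, hi⟩ := Function.ne_iff.1 (h0 k)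
    have h1 : l (Pi.single k (Pi.single i 1)) = 0 := by rw [hl]; rfl
    have h2 : l (Pi.single k (Pi.single i 1)) = c k * d k i := by
      change ∑ j, c j * pairing (d j) (_) = _
      rw [Finset.sum_eq_single k]
      · simp [pairing, Pi.single_apply]
      · intro j _ hj
        simp [hj, pairing_zero]
      · simp
    rw [h2] at h1
    rcases mul_eq_zero.1 h1 with h | h
    · exact hk h
    · exact hi (by exact_mod_cast h)
  · intro u hu w hw
    apply hu
    change ∑ j, c j * pairing (d j) (u j) = 0
    have h1 : ∀ j, pairing (d j) (u j) = pairing (d j) w := fun j => by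
      have := hw j
      rw [pairing_sub] at this
      linarith
    rw [Finset.sum_congr rfl fun j _ => congrArg (c j * ·) (h1 j)]
    simp only [pairing, Finset.mul_sum]
    rw [Finset.sum_comm]
    refine Finset.sum_eq_zero fun i _ => ?_
    simp only [← mul_assoc]
    rw [← Finset.sum_mul, hcol, zero_mul]

/-- For generic translations of the terms with exponents in the finite set `S`, only linearly
independent edges with end points in `S` can be tight at a common point. -/
theorem exists_generic_functionals (S : Finset (Fin n → ℤ)) :
    ∃ L : Finset ((Fin n → Fin n → ℝ) →ₗ[ℝ] ℝ), (∀ l ∈ L, l ≠ 0) ∧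
      ∀ u, (∀ l ∈ L, l u ≠ 0) → ∀ P Q : Fin n → Fin n → ℤ, (∀ j, P j ∈ S) → (∀ j, Q j ∈ S) →
        (∀ j, P j ≠ Q j) → ∀ w, (∀ j, pairing (Q j) (w - u j) = pairing (P j) (w - u j)) →
          (Matrix.of fun j => Q j - P j).det ≠ 0 := by
  classical
  let D : Finset (Matrix (Fin n) (Fin n) ℤ) :=
    ((Fintype.piFinset fun _ : Fin n => (S ×ˢ S).image fun x => x.1 - x.2).image Matrix.of).filter
      fun d => d.det = 0 ∧ ∀ j, d j ≠ 0
  have hD : ∀ d ∈ D, d.det = 0 ∧ ∀ j, d j ≠ 0 := fun d hd => (Finset.mem_filter.1 hd).2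
  choose! f hf0 hf using fun d (hd : d ∈ D) =>
    exists_functional_of_det_eq_zero d (hD d hd).1 (hD d hd).2
  refine ⟨D.image f, ?_, ?_⟩
  · intro l hl
    obtain ⟨d, hd, rfl⟩ := Finset.mem_image.1 hl
    exact hf0 d hd
  · intro u hu P Q hP hQ hPQ w hw hdet
    have hd : (Matrix.of fun j => Q j - P j) ∈ D := by
      refine Finset.mem_filter.2 ⟨Finset.mem_image.2 ⟨_, ?_, rfl⟩, hdet, fun j => ?_⟩
      · refine Fintype.mem_piFinset.2 fun j => Finset.mem_image.2 ⟨(Q j, P j), ?_, rfl⟩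
        exact Finset.mem_product.2 ⟨hQ j, hP j⟩
      · exact sub_ne_zero.2 (hPQ j).symm
    refine hf _ hd u (hu _ (Finset.mem_image_of_mem f hd)) w fun j => ?_
    change pairing (Q j - P j) _ = 0
    rw [sub_pairing, hw j, sub_self]

/-- Near the origin there are vectors off the kernels of finitely many nonzero functionals. -/
theorem exists_mem_forall_functional_ne_zero {E : Type*} [NormedAddCommGroup E] [NormedSpace ℝ E]
    (L : Finset (E →ₗ[ℝ] ℝ)) (hL : ∀ l ∈ L, l ≠ 0) {p : E → Prop} (hp : ∀ᶠ u in nhds 0, p u) :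
    ∃ u, p u ∧ ∀ l ∈ L, l u ≠ 0 := by
  classical
  have hcover := Subspace.biUnion_ne_univ_of_top_notMem (k := ℝ) (E := E)
    (s := L.image LinearMap.ker) (by
      simp only [Finset.mem_image, not_exists, not_and]
      exact fun l hl h => hL l hl (LinearMap.ker_eq_top.1 h))
  obtain ⟨e, he⟩ := (Set.ne_univ_iff_exists_notMem _).1 hcover
  have hcont : Filter.Tendsto (fun t : ℝ => t • e) (nhdsWithin 0 (Set.Ioi 0)) (nhds 0) := by
    have : Continuous fun t : ℝ => t • e := by fun_prop
    simpa using (this.tendsto 0).mono_left nhdsWithin_le_nhds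
  obtain ⟨t, ht, ht0⟩ := ((hcont.eventually hp).and self_mem_nhdsWithin).exists
  refine ⟨t • e, ht, fun l hl h0 => he ?_⟩
  rw [map_smul, smul_eq_mul] at h0
  have : l e = 0 := (mul_eq_zero.1 h0).resolve_left (ne_of_gt ht0)
  simp only [Set.mem_iUnion]
  exact ⟨LinearMap.ker l, Finset.mem_image_of_mem _ hl, this⟩

end Generic

/-! ### Stable multiplicities -/

section Multiplicity

variable {n : ℕ} {h : TropicalLaurentPoly n} {p : Fin n → ℝ}

/-- Small translations of points near `p` remain in a given neighbourhood of `p`. -/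
theorem eventually_forall_translate {q : (Fin n → ℝ) → Prop} (hq : ∀ᶠ w in nhds p, q w) :
    ∀ᶠ r in nhdsWithin (0 : ℝ) (Set.Ioi 0), ∀ᶠ u in nhds (0 : Fin n → Fin n → ℝ),
      ∀ w ∈ Metric.ball p r, ∀ j, q (w - u j) := by
  obtain ⟨ε, hε, hball⟩ := Metric.eventually_nhds_iff.1 hq
  filter_upwards [Ioo_mem_nhdsGT (half_pos hε)] with r hr
  filter_upwards [Metric.ball_mem_nhds (0 : Fin n → Fin n → ℝ) (half_pos hε)] with u hu w hw j
  apply hball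
  have h1 : ‖u j‖ < ε / 2 := (norm_le_pi_norm u j).trans_lt (by simpa using hu)
  have h2 : ‖w - p‖ < r := by simpa [dist_eq_norm] using hw
  rw [dist_eq_norm, sub_right_comm]
  exact (norm_sub_le _ _).trans_lt (by linarith [hr.2])

theorem mem_inter_translatedHypersurface {u : Fin n → Fin n → ℝ} {w : Fin n → ℝ} :
    w ∈ ⋂ i, translatedHypersurface h (u i) ↔ ∀ i, (activeExponents h (w - u i)).Nontrivial := by
  simp [translatedHypersurface, tropicalHypersurface]

/-- If the differences of the exponents that are active at `p` do not span the whole space, then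
generic translates of the hypersurface have no common point near `p`. -/
theorem hasStableMultiplicity_zero
    (H : ∀ P Q : Fin n → Fin n → ℤ, (∀ j, P j ∈ activeExponents h p) →
      (∀ j, Q j ∈ activeExponents h p) → (Matrix.of fun j => Q j - P j).det = 0) :
    HasStableMultiplicity (fun _ : Fin n => h) p 0 := by
  obtain ⟨L, hL, hgen⟩ := exists_generic_functionals h.coeff.support
  refine ⟨L, hL, ?_⟩
  filter_upwards [eventually_forall_translate (eventually_mem_activeExponents_iff h p)] with r hr
  filter_upwards [hr] with u hu hLu
  refine ⟨∅, fun _ => 0, ?_, by simp, by simp⟩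
  rw [Finset.coe_empty, eq_comm, Set.eq_empty_iff_forall_notMem]
  rintro w ⟨hw, hw'⟩
  rw [mem_inter_translatedHypersurface] at hw'
  choose P hP Q hQ hPQ using hw'
  have hP' := fun j => (hu w hw j (P j)).1 (hP j)
  have hQ' := fun j => (hu w hw j (Q j)).1 (hQ j)
  refine hgen u hLu P Q (fun j => (mem_activeExponents.1 (hP j)).1)
    (fun j => (mem_activeExponents.1 (hQ j)).1) hPQ (w - p) (fun j => ?_)
    (H P Q (fun j => (hP' j).1) fun j => (hQ' j).1)
  rw [sub_right_comm]
  exact le_antisymm ((hQ' j).2 _ (hP' j).1) ((hP' j).2 _ (hQ' j).1)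

/-- A point of stable multiplicity zero has no other stable multiplicity. -/
theorem HasStableMultiplicity.eq_zero {m : ℕ} (h0 : HasStableMultiplicity (fun _ : Fin n => h) p 0)
    (hm : HasStableMultiplicity (fun _ : Fin n => h) p m) : m = 0 := by
  classical
  obtain ⟨L, hL, hr⟩ := h0
  obtain ⟨L', hL', hr'⟩ := hm
  obtain ⟨r, hr1, hr2⟩ := (hr.and hr').exists
  obtain ⟨u, ⟨h1, h2⟩, hu⟩ := exists_mem_forall_functional_ne_zero (L ∪ L')
    (fun l hl => (Finset.mem_union.1 hl).elim (hL l) (hL' l)) (hr1.and hr2)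
  obtain ⟨s, μ, hs, hμ, hsum⟩ := h1 fun l hl => hu l (Finset.mem_union_left _ hl)
  obtain ⟨s', μ', hs', -, hsum'⟩ := h2 fun l hl => hu l (Finset.mem_union_right _ hl)
  have hempty : s = ∅ := by
    refine Finset.eq_empty_of_forall_notMem fun w hw => ?_
    obtain ⟨d, -, hd, hd'⟩ := hμ w hw
    have := (Finset.sum_eq_zero_iff.1 hsum) w hw
    exact hd (Int.natAbs_eq_zero.1 (hd' ▸ this))
  have : s' = s := Finset.coe_injective (hs'.trans hs.symm)
  rw [← hsum', this, hempty, Finset.sum_empty]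

/-- If the exponents that are active at `p` are the vertices of a unimodular simplex, then near `p`
the hypersurface is a tropical hyperplane in suitable integral coordinates, and so `n` generic
translates of it meet in one point, with multiplicity one. -/
theorem hasStableMultiplicity_one {b : Matrix (Fin n) (Fin n) ℤ} (hb : IsUnit b.det)
    (hact : activeExponents h p = Set.range fun o : Option (Fin n) => o.elim 0 b) :
    HasStableMultiplicity (fun _ : Fin n => h) p 1 := by
  classical
  let β : Option (Fin n) → Fin n → ℤ := fun o => o.elim 0 b
  have hβ : ∀ o, β o ∈ activeExponents h p := fun o => hact ▸ Set.mem_range_self o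
  obtain ⟨L, hL, hgen⟩ := exists_generic_functionals h.coeff.support
  refine ⟨L, hL, ?_⟩
  -- The coordinates `⟨β o, ·⟩`, and the inverse of this change of coordinates.
  let B : Matrix (Fin n) (Fin n) ℝ := b.map (Int.castRingHom ℝ)
  have hB : IsUnit B.det := by
    have : B.det = Int.castRingHom ℝ b.det := (RingHom.map_det (Int.castRingHom ℝ) b).symm
    rw [this]
    exact hb.map (Int.castRingHom ℝ)
  let point : (Option (Fin n) → ℝ) → Fin n → ℝ := fun x => B⁻¹.mulVec fun i => x (some i)
  have hBmul : ∀ (w : Fin n → ℝ) i, B.mulVec w i = pairing (b i) w := fun w i => by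
    simp [B, Matrix.mulVec, dotProduct, pairing]
  have pairing_point : ∀ x : Option (Fin n) → ℝ, x none = 0 →
      ∀ o, pairing (β o) (point x) = x o := by
    rintro x hx (_ | i)
    · exact (zero_pairing _).trans hx.symm
    · change pairing (b i) _ = _
      rw [← hBmul, Matrix.mulVec_mulVec, Matrix.mul_nonsing_inv _ hB, Matrix.one_mulVec]
  have point_pairing : ∀ w : Fin n → ℝ, point (fun o => pairing (β o) w) = w := by
    intro w
    have : (fun i => pairing (β (some i)) w) = B.mulVec w := funext fun i => (hBmul w i).symm
    change B⁻¹.mulVec (fun i => pairing (β (some i)) w) = w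
    rw [this, Matrix.mulVec_mulVec, Matrix.nonsing_inv_mul _ hB, Matrix.one_mulVec]
  have hpoint0 : point 0 = 0 := by
    have := point_pairing 0
    simp only [pairing_zero] at this
    exact this
  have hpoint : Continuous point := by
    change Continuous fun x : Option (Fin n) → ℝ => B⁻¹.mulVec fun i => x (some i)
    fun_prop
  have β_inj : Function.Injective β := by
    intro o o' ho
    -- Coordinates that differ for `o`, for `none` and for all other indices.
    let y : Option (Fin n) → ℝ := fun i => if i = none then 0 else if i = o then 1 else 2
    have h1 := pairing_point y (by simp [y])
    have h2 : y o = y o' := by rw [← h1 o, ← h1 o', ho]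
    have h3 : ∀ i : Option (Fin n), i = none ∨ ∃ j, i = some j := by rintro (_ | j) <;> simp
    by_contra hne
    rcases h3 o with rfl | ⟨j, rfl⟩ <;> rcases h3 o' with rfl | ⟨k, rfl⟩
    · exact hne rfl
    · simp [y] at h2
    · simp [y] at h2
    · simp [y, Ne.symm hne] at h2
  -- The coefficients of the tropical hyperplanes and the tropical Cramer solution.
  let A : (Fin n → Fin n → ℝ) → Fin n → Option (Fin n) → ℝ := fun u j o => -pairing (β o) (u j)
  have hA : Continuous A := by
    refine continuous_pi fun j => continuous_pi fun o => ?_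
    exact ((continuous_pairing _).comp (continuous_apply j)).neg
  let X : (Fin n → Fin n → ℝ) → Option (Fin n) → ℝ := fun u o =>
    tropicalMinor (A u) o - tropicalMinor (A u) none
  let W : (Fin n → Fin n → ℝ) → Fin n → ℝ := fun u => p + point (X u)
  have hX : Continuous X := continuous_pi fun o =>
    ((continuous_tropicalMinor o).comp hA).sub ((continuous_tropicalMinor none).comp hA)
  have hA0 : A 0 = 0 := by
    funext j o
    simp [A, pairing_zero]
  have hX0 : X 0 = 0 := by
    funext o
    simp [X, hA0, tropicalMinor_zero]
  have hW : Continuous W := continuous_const.add (hpoint.comp hX)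
  have hW0 : W 0 = p := by simp [W, hX0, hpoint0]
  filter_upwards [eventually_forall_translate (eventually_mem_activeExponents_iff h p),
    self_mem_nhdsWithin] with r hr hr0
  have hWr : ∀ᶠ u in nhds 0, W u ∈ Metric.ball p r :=
    (hW.tendsto 0).eventually (by rw [hW0]; exact Metric.ball_mem_nhds p hr0)
  filter_upwards [hr, hWr] with u hu hWu hLu
  -- The active exponents at `w - u j` in terms of the coordinates of `w`.
  have active_iff : ∀ w ∈ Metric.ball p r, ∀ j o, β o ∈ activeExponents h (w - u j) ↔
      ∀ o', A u j o + pairing (β o) (w - p) ≤ A u j o' + pairing (β o') (w - p) := by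
    intro w hw j o
    have hval : ∀ o, pairing (β o) (w - u j - p) = A u j o + pairing (β o) (w - p) := fun o => by
      rw [sub_right_comm, pairing_sub _ (w - p)]
      simp only [A]
      ring
    rw [hu w hw j, hact]
    simp only [Set.forall_mem_range]
    constructor
    · rintro ⟨-, h2⟩ o'
      rw [← hval, ← hval]
      exact h2 o'
    · intro h2
      refine ⟨⟨o, rfl⟩, fun o' => ?_⟩
      have := h2 o'
      rwa [← hval, ← hval] at this
  have active_sub : ∀ w ∈ Metric.ball p r, ∀ j, ∀ m ∈ activeExponents h (w - u j),
      ∃ o, β o = m := by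
    intro w hw j m hm
    have := ((hu w hw j m).1 hm).1
    rwa [hact] at this
  -- Tight edges are independent.
  have independent : ∀ (P Q : Fin n → Option (Fin n)) (g : Option (Fin n) → ℝ), g none = 0 →
      (∀ j, P j ≠ Q j) → (∀ j, A u j (P j) + g (P j) = A u j (Q j) + g (Q j)) →
        (Matrix.of fun j => β (Q j) - β (P j)).det ≠ 0 := by
    intro P Q g hg hPQ hedge
    have hmem : ∀ o, β o ∈ h.coeff.support := fun o => (mem_activeExponents.1 (hβ o)).1
    refine hgen u hLu _ _ (fun j => hmem _) (fun j => hmem _) (fun j => β_inj.ne (hPQ j)) (point g)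
      fun j => ?_
    have := hedge j
    rw [pairing_sub, pairing_sub, pairing_point g hg, pairing_point g hg]
    simp only [A] at this
    linarith
  -- The coordinates of a common point of the translates lie on all the tropical hyperplanes.
  have attained : ∀ w ∈ Metric.ball p r, (∀ j, (activeExponents h (w - u j)).Nontrivial) →
      ∀ j, MinAttainedTwice fun o => A u j o + pairing (β o) (w - p) := by
    intro w hw hw' j
    obtain ⟨m, hm, m', hm', hne⟩ := hw' j
    obtain ⟨o, rfl⟩ := active_sub w hw j m hm
    obtain ⟨o', rfl⟩ := active_sub w hw j m' hm'
    exact ⟨o, o', fun h => hne (congrArg β h), (active_iff w hw j o).1 hm,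
      (active_iff w hw j o').1 hm'⟩
  have hXnone : X u none = 0 := sub_self _
  have hWX : ∀ o, pairing (β o) (W u - p) = X u o := fun o => by
    simp only [W, add_sub_cancel_left]
    exact pairing_point (X u) hXnone o
  have hcramer : ∀ j, MinAttainedTwice fun o => A u j o + X u o := by
    intro j
    obtain ⟨o, o', hne, h1, h2⟩ := minAttainedTwice_add_tropicalMinor (A u) j
    refine ⟨o, o', hne, fun k => ?_, fun k => ?_⟩
    · have := h1 k
      simp only [X]
      linarith
    · have := h2 k
      simp only [X]
      linarith
  choose P Q hPQ hPmin hQmin using hcramer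
  have hPact : ∀ j, β (P j) ∈ activeExponents h (W u - u j) := fun j =>
    (active_iff _ hWu j _).2 fun o' => by rw [hWX, hWX]; exact hPmin j o'
  have hQact : ∀ j, β (Q j) ∈ activeExponents h (W u - u j) := fun j =>
    (active_iff _ hWu j _).2 fun o' => by rw [hWX, hWX]; exact hQmin j o'
  refine ⟨{W u}, fun _ => 1, ?_, ?_, by simp⟩
  · rw [Finset.coe_singleton]
    refine Set.Subset.antisymm ?_ ?_
    · rintro w rfl
      exact ⟨hWu, mem_inter_translatedHypersurface.2 fun j =>
        ⟨_, hPact j, _, hQact j, β_inj.ne (hPQ j)⟩⟩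
    · rintro w ⟨hw, hw'⟩
      have hzero := attained w hw (mem_inter_translatedHypersurface.1 hw')
      by_contra hne
      have hneX : (fun o => pairing (β o) (w - p)) ≠ X u := by
        intro heq
        apply hne
        have h1 := point_pairing (w - p)
        rw [heq] at h1
        simp [W, h1]
      obtain ⟨P', Q', g, z, h1, h2, h3, hg, hz0, hz⟩ := exists_degenerate_edges
        (zero_pairing _) hXnone hzero (fun j => ⟨P j, Q j, hPQ j, hPmin j, hQmin j⟩) hneX
      refine independent P' Q' g hg h1 h2 (det_eq_zero_of_pairing_eq_zero _ (z := point z) ?_ ?_)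
      · intro h0
        apply hz
        funext o
        rw [← pairing_point z hz0, h0, pairing_zero, Pi.zero_apply]
      · intro j
        change pairing (β (Q' j) - β (P' j)) _ = 0
        rw [sub_pairing, pairing_point z hz0, pairing_point z hz0, h3, sub_self]
  · intro w hw
    obtain rfl := Finset.mem_singleton.1 hw
    -- The determinant of any choice of tight edges is odd.
    have hdet : ∀ P' Q' : Fin n → Option (Fin n), (∀ j, P' j ≠ Q' j) →
        (∀ j o, A u j (P' j) + X u (P' j) ≤ A u j o + X u o) →
        (∀ j o, A u j (Q' j) + X u (Q' j) ≤ A u j o + X u o) →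
        (Matrix.of fun j => β (Q' j) - β (P' j)).det ≠ 0 ∧
          (Matrix.of fun j => β (Q' j) - β (P' j)).det.natAbs = 1 := by
      intro P' Q' hne h1 h2
      have h3 := independent P' Q' (X u) hXnone hne fun j => le_antisymm (h1 j _) (h2 j _)
      exact ⟨h3, natAbs_det_unimodular_edges hb P' Q' h3⟩
    refine ⟨Matrix.of fun j => β (Q j) - β (P j), fun j => ?_, (hdet P Q hPQ hPmin hQmin).1,
      (hdet P Q hPQ hPmin hQmin).2.symm⟩
    refine ⟨β (P j), hPact j, β (Q j), hQact j, β_inj.ne (hPQ j), rfl, fun m hm => ?_⟩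
    obtain ⟨o, rfl⟩ := active_sub _ hWu j m hm
    have homin := (active_iff _ hWu j o).1 hm
    simp only [hWX] at homin
    by_cases hoP : o = P j
    · subst hoP
      exact left_mem_segment ℝ _ _
    by_cases hoQ : o = Q j
    · subst hoQ
      exact right_mem_segment ℝ _ _
    -- A third tight column `o` in the row `j` is impossible: the determinants for the edges
    -- `P j → o` and `o → Q j` add up to the one for `P j → Q j`, and all three are odd.
    exfalso
    have hPo := hdet P (Function.update Q j o)
      (fun k => by
        by_cases hk : k = j
        · subst hk; simpa using Ne.symm hoP
        · simpa [hk] using hPQ k) hPmin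
      (fun k => by
        by_cases hk : k = j
        · subst hk; simpa using homin
        · simpa [hk] using hQmin k)
    have hoQ' := hdet (Function.update P j o) Q
      (fun k => by
        by_cases hk : k = j
        · subst hk; simpa using hoQ
        · simpa [hk] using hPQ k)
      (fun k => by
        by_cases hk : k = j
        · subst hk; simpa using homin
        · simpa [hk] using hPmin k) hQmin
    have hPQ' := hdet P Q hPQ hPmin hQmin
    let M : Matrix (Fin n) (Fin n) ℤ := Matrix.of fun k => β (Q k) - β (P k)
    have e1 : (Matrix.of fun k => β (Function.update Q j o k) - β (P k)) =
        M.updateRow j (β o - β (P j)) := by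
      ext k i
      by_cases hk : k = j
      · subst hk; simp
      · simp [M, hk]
    have e2 : (Matrix.of fun k => β (Q k) - β (Function.update P j o k)) =
        M.updateRow j (β (Q j) - β o) := by
      ext k i
      by_cases hk : k = j
      · subst hk; simp
      · simp [M, hk]
    have e3 : M = M.updateRow j ((β o - β (P j)) + (β (Q j) - β o)) := by
      rw [sub_add_sub_cancel']
      exact (Matrix.updateRow_eq_self M j).symm
    have hsum := Matrix.det_updateRow_add M j (β o - β (P j)) (β (Q j) - β o)
    rw [← e1, ← e2, ← e3] at hsum
    have h1 := hPo.2
    have h2 := hoQ'.2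
    have h3 := hPQ'.2
    change M.det.natAbs = 1 at h3
    omega

end Multiplicity

/-! ### The tropical polynomial of a cycle -/

/-- The exponent vector of `x_{e+1} / x_e`, for the edge `{e, e + 1}` of the cycle on `n + 1`
vertices, which is indexed by the vertex `e`. -/
def edgeExponent {n : ℕ} (e : Fin (n + 1)) : Fin n → ℤ :=
  vertexExponent (e + 1) - vertexExponent e

/-- The valuation of the coefficients that belong to the edge `{e, e + 1}` of the cycle. -/
def edgeWeight (n : ℕ) (e : Fin (n + 1)) : ℤ :=
  1 + if Even (n + 1) ∧ e = 0 then 1 else 0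

/-- The tropical polynomial `min(0, C_e ± (w_{e+1} - w_e))`, described by its coefficients, where
`C_e` is the weight of the edge `{e, e + 1}` of the cycle. -/
structure IsCycleTropical {n : ℕ} (h : TropicalLaurentPoly n) : Prop where
  coeff_zero : h.coeff 0 = Tropical.trop 0
  coeff_edge : ∀ e, h.coeff (edgeExponent e) = Tropical.trop ((edgeWeight n e : ℝ) : WithTop ℝ)
  coeff_neg_edge :
    ∀ e, h.coeff (-edgeExponent e) = Tropical.trop ((edgeWeight n e : ℝ) : WithTop ℝ)
  coeff_other : ∀ m, m ≠ 0 → (∀ e, m ≠ edgeExponent e) → (∀ e, m ≠ -edgeExponent e) →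
    h.coeff m = 0

section Cycle

variable {n : ℕ}

theorem IsCycleTropical.unique {h h' : TropicalLaurentPoly n} (H : IsCycleTropical h)
    (H' : IsCycleTropical h') : h = h' := by
  refine AddMonoidAlgebra.ext (Finsupp.ext fun m => ?_)
  by_cases h0 : m = 0
  · rw [h0, H.coeff_zero, H'.coeff_zero]
  by_cases h1 : ∃ e, m = edgeExponent e
  · obtain ⟨e, rfl⟩ := h1
    rw [H.coeff_edge, H'.coeff_edge]
  by_cases h2 : ∃ e, m = -edgeExponent e
  · obtain ⟨e, rfl⟩ := h2
    rw [H.coeff_neg_edge, H'.coeff_neg_edge]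
  push Not at h1 h2
  rw [H.coeff_other m h0 h1 h2, H'.coeff_other m h0 h1 h2]

theorem pairing_vertexExponent (W : Fin (n + 1) → ℝ) (i : Fin (n + 1)) :
    pairing (vertexExponent i) (fun l => W l.succ - W 0) = W i - W 0 := by
  refine Fin.cases ?_ (fun j => ?_) i
  · simp [vertexExponent, pairing]
  · simp [vertexExponent, pairing, Pi.single_apply]

theorem vertexExponent_sub_inj {i j i' j' : Fin (n + 1)} (hij : i ≠ j)
    (h : (vertexExponent i - vertexExponent j : Fin n → ℤ) =
      vertexExponent i' - vertexExponent j') : i = i' ∧ j = j' := by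
  have key : ∀ W : Fin (n + 1) → ℝ, W i - W j = W i' - W j' := by
    intro W
    have := congrArg (fun m => pairing m fun l => W l.succ - W 0) h
    simp only [sub_pairing, pairing_vertexExponent] at this
    linarith
  have h1 := key fun l => if l = i then 1 else 0
  have h2 := key fun l => if l = j then 1 else 0
  simp only [if_true, if_neg hij, if_neg hij.symm] at h1 h2
  constructor
  · by_contra hne
    rw [if_neg (Ne.symm hne)] at h1
    split_ifs at h1 <;> norm_num at h1
  · by_contra hne
    rw [if_neg (Ne.symm hne)] at h2
    split_ifs at h2 <;> norm_num at h2

theorem cycleGraph_adj_iff (hn : 2 < n + 1) (i j : Fin (n + 1)) :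
    (SimpleGraph.cycleGraph (n + 1)).Adj i j ↔ i = j + 1 ∨ j = i + 1 := by
  obtain ⟨m, rfl⟩ : ∃ m, n = m + 1 := ⟨n - 1, by omega⟩
  rw [SimpleGraph.cycleGraph_adj, sub_eq_iff_eq_add', sub_eq_iff_eq_add']

theorem cycleWeight_edge (hn : 2 < n + 1) (e : Fin (n + 1)) :
    cycleWeight n (e + 1) e = ((edgeWeight n e : ℝ) : WithTop ℝ) := by
  have hne : (1 : Fin (n + 1)) + 1 ≠ 0 := by
    obtain ⟨m, rfl⟩ : ∃ m, n = m + 2 := ⟨n - 2, by omega⟩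
    simp [Fin.ext_iff, Fin.val_add, Nat.mod_eq_of_lt]
  have hs : s(e + 1, e) = s(1, 0) ↔ e = 0 := by
    rw [Sym2.eq_iff]
    constructor
    · rintro (⟨-, h⟩ | ⟨h, rfl⟩)
      · exact h
      · exact absurd h hne
    · rintro rfl
      simp
  unfold cycleWeight edgeWeight
  simp only [hs]
  split_ifs
  · norm_num
  · norm_num

theorem cycleWeight_edge' (hn : 2 < n + 1) (e : Fin (n + 1)) :
    cycleWeight n e (e + 1) = ((edgeWeight n e : ℝ) : WithTop ℝ) := by
  rw [← cycleWeight_edge hn, cycleWeight, cycleWeight, Sym2.eq_swap]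

theorem isCycleTropical_tropicalize {K : Type*} [Field K] (v : AddValuation K (WithTop ℝ))
    (hn : 2 < n + 1) (c : Fin n → K) (a : Fin (n + 1) → Fin (n + 1) → Fin n → K)
    (hc : ∀ k, v (c k) = 0)
    (ha : ∀ i j k, (SimpleGraph.cycleGraph (n + 1)).Adj i j → v (a i j k) = cycleWeight n i j)
    (k : Fin n) :
    IsCycleTropical (tropicalize v (unmixedEquation (SimpleGraph.cycleGraph (n + 1)) c a k)) := by
  have coeff_eq : ∀ m, (unmixedEquation (SimpleGraph.cycleGraph (n + 1)) c a k).coeff m =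
      (if m = 0 then c k else 0) - ∑ i, ∑ j with (SimpleGraph.cycleGraph (n + 1)).Adj i j,
        if m = vertexExponent i - vertexExponent j then a i j k else 0 := by
    intro m
    simp [unmixedEquation, ratioMonomial, AddMonoidAlgebra.coeff_sum, Finsupp.single_apply,
      eq_comm]
  have trop_eq : ∀ m, (tropicalize v (unmixedEquation (SimpleGraph.cycleGraph (n + 1)) c a k)).coeff
      m = Tropical.trop (v ((unmixedEquation (SimpleGraph.cycleGraph (n + 1)) c a k).coeff m)) :=
    fun m => rfl
  have adj_ne : ∀ i j, (SimpleGraph.cycleGraph (n + 1)).Adj i j →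
      (vertexExponent i - vertexExponent j : Fin n → ℤ) ≠ 0 := by
    intro i j hij h0
    have := vertexExponent_sub_inj (n := n) (i := i) (j := j) (i' := j) (j' := j) hij.ne
      (by rw [h0, sub_self])
    exact hij.ne this.1
  have edge_coeff : ∀ i j, (SimpleGraph.cycleGraph (n + 1)).Adj i j →
      (tropicalize v (unmixedEquation (SimpleGraph.cycleGraph (n + 1)) c a k)).coeff
        (vertexExponent i - vertexExponent j) = Tropical.trop (cycleWeight n i j) := by
    intro i j hij
    rw [trop_eq, coeff_eq, if_neg (adj_ne i j hij), Finset.sum_eq_single i, Finset.sum_eq_single j,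
      if_pos rfl, zero_sub, AddValuation.map_neg, ha i j k hij]
    · intro j' _ hne
      rw [if_neg]
      intro h
      exact hne (vertexExponent_sub_inj hij.ne h).2.symm
    · simp [hij]
    · intro i' _ hne
      refine Finset.sum_eq_zero fun j' _ => if_neg fun h => ?_
      exact hne (vertexExponent_sub_inj hij.ne h).1.symm
    · simp
  have adj1 : ∀ e : Fin (n + 1), (SimpleGraph.cycleGraph (n + 1)).Adj (e + 1) e := fun e =>
    (cycleGraph_adj_iff hn _ _).2 (Or.inl rfl)
  refine ⟨?_, fun e => ?_, fun e => ?_, fun m h0 h1 h2 => ?_⟩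
  · rw [trop_eq, coeff_eq, if_pos rfl, Finset.sum_eq_zero, sub_zero, hc]
    intro i _
    refine Finset.sum_eq_zero fun j hj => if_neg fun h => ?_
    exact adj_ne i j (Finset.mem_filter.1 hj).2 h.symm
  · rw [edgeExponent, edge_coeff _ _ (adj1 e), cycleWeight_edge hn]
  · rw [edgeExponent, neg_sub, edge_coeff _ _ (adj1 e).symm, cycleWeight_edge' hn]
  · rw [trop_eq, coeff_eq, if_neg h0, Finset.sum_eq_zero, sub_zero, AddValuation.map_zero]
    · rfl
    intro i _
    refine Finset.sum_eq_zero fun j hj => if_neg ?_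
    rcases (cycleGraph_adj_iff hn i j).1 (Finset.mem_filter.1 hj).2 with rfl | rfl
    · exact h1 j
    · rw [← neg_sub]
      exact h2 i

/-! ### Slopes along the cycle -/

theorem sum_pairing_edgeExponent (p : Fin n → ℝ) : ∑ e, pairing (edgeExponent e) p = 0 := by
  simp only [edgeExponent, sub_pairing, Finset.sum_sub_distrib]
  rw [sub_eq_zero]
  exact Fintype.sum_equiv (Equiv.addRight 1) _ _ fun e => rfl

theorem pairing_edgeExponent_eq_neg_sum (p : Fin n → ℝ) (k : Fin (n + 1)) :
    pairing (edgeExponent k) p = -∑ e ∈ Finset.univ.erase k, pairing (edgeExponent e) p := by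
  have := sum_pairing_edgeExponent p
  rw [← Finset.add_sum_erase _ _ (Finset.mem_univ k)] at this
  linarith

/-- A point is determined by all its slopes but one. -/
theorem eq_zero_of_pairing_edgeExponent_eq_zero {p : Fin n → ℝ} (k : Fin (n + 1))
    (h : ∀ e, e ≠ k → pairing (edgeExponent e) p = 0) : p = 0 := by
  have hall : ∀ e, pairing (edgeExponent e) p = 0 := by
    intro e
    by_cases he : e = k
    · rw [he, pairing_edgeExponent_eq_neg_sum, neg_eq_zero]
      exact Finset.sum_eq_zero fun e he => h e (Finset.ne_of_mem_erase he)
    · exact h e he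
  have hvertex : ∀ i : Fin (n + 1), pairing (vertexExponent i) p = 0 := by
    intro i
    induction i using Fin.induction with
    | zero => exact zero_pairing p
    | succ i ih =>
      have := hall i.castSucc
      rw [edgeExponent, sub_pairing, ih, sub_zero, Fin.coeSucc_eq_succ] at this
      exact this
  funext i
  have := hvertex i.succ
  simpa [vertexExponent, pairing, Pi.single_apply] using this

/-- Up to signs, any `n` of the `n + 1` edge vectors of the cycle form a basis of the lattice. -/
theorem isUnit_det_edgeExponent (k : Fin (n + 1)) (s : Fin n → ℤ) (hs : ∀ i, s i = 1 ∨ s i = -1) :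
    IsUnit (Matrix.of fun i => s i • edgeExponent (k.succAbove i)).det := by
  rw [Int.isUnit_iff_natAbs_eq]
  have hle := natAbs_det_simplex_edges_le
    (Matrix.of fun i => s i • edgeExponent (k.succAbove i)) fun i => by
      change ∃ p q, s i • edgeExponent (k.succAbove i) = _
      simp only [edgeExponent, vertexExponent_eq_simplexVertex]
      rcases hs i with h | h
      · exact ⟨_, _, by rw [h, one_smul]⟩
      · exact ⟨_, _, by rw [h, neg_one_smul, neg_sub]⟩
  have hne : (Matrix.of fun i => s i • edgeExponent (k.succAbove i)).det ≠ 0 := by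
    refine det_ne_zero_of_forall_pairing _ fun z hz => ?_
    refine eq_zero_of_pairing_edgeExponent_eq_zero k fun e he => ?_
    obtain ⟨i, rfl⟩ := Fin.exists_succAbove_eq he
    have : pairing (s i • edgeExponent (k.succAbove i)) z = 0 := hz i
    rcases hs i with h | h
    · simpa [h] using this
    · simpa [h, neg_pairing] using this
  have := Int.natAbs_ne_zero.2 hne
  omega

/-- All slopes but one can be prescribed. -/
theorem exists_pairing_edgeExponent_eq (k : Fin (n + 1)) (y : Fin (n + 1) → ℝ) :
    ∃ p : Fin n → ℝ, ∀ e, e ≠ k → pairing (edgeExponent e) p = y e := by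
  obtain ⟨p, hp⟩ := exists_pairing_eq
    (isUnit_det_edgeExponent k (fun _ => 1) fun _ => Or.inl rfl).ne_zero fun i => y (k.succAbove i)
  refine ⟨p, fun e he => ?_⟩
  obtain ⟨i, rfl⟩ := Fin.exists_succAbove_eq he
  have : pairing ((1 : ℤ) • edgeExponent (k.succAbove i)) p = y (k.succAbove i) := hp i
  rwa [one_smul] at this

end Cycle

/-! ### The stable self-intersection points -/

/-- The points at which all edges `e` of the cycle but one, `k`, are tight, that is, the slope along
`e` is the weight of `e` up to sign. -/
def cycleVertices (n : ℕ) : Set (Fin n → ℝ) :=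
  {p | ∃ k : Fin (n + 1), (∀ e, e ≠ k → |pairing (edgeExponent e) p| = edgeWeight n e) ∧
    |pairing (edgeExponent k) p| < edgeWeight n k}

section Vertices

variable {n : ℕ}

theorem edgeWeight_pos (e : Fin (n + 1)) : (0 : ℝ) < edgeWeight n e := by
  unfold edgeWeight
  split_ifs <;> norm_num

/-- The weights are chosen such that no signed sum of them vanishes, not even after an increase of
all of them by the same amount. -/
theorem signed_sum_edgeWeight_ne_zero (s : Fin (n + 1) → ℤ) (hs : ∀ e, s e = 1 ∨ s e = -1) {t : ℝ}
    (ht : 0 ≤ t) : ∑ e, (s e : ℝ) * (edgeWeight n e + t) ≠ 0 := by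
  intro h0
  have hpar : (2 : ℤ) ∣ ∑ e, s e - (n + 1 : ℕ) := by
    have : ∑ e, s e - (n + 1 : ℕ) = ∑ e, (s e - 1) := by simp [Finset.sum_sub_distrib]
    rw [this]
    refine Finset.dvd_sum fun e _ => ?_
    rcases hs e with h | h <;> simp [h]
  have hsum : ∑ e, (s e : ℝ) * (edgeWeight n e + t) =
      ((∑ e, s e : ℤ) : ℝ) * (1 + t) + if Even (n + 1) then (s 0 : ℝ) else 0 := by
    have hterm : ∀ e, (s e : ℝ) * (edgeWeight n e + t) =
        s e * (1 + t) + if e = 0 then (if Even (n + 1) then (s e : ℝ) else 0) else 0 := by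
      intro e
      unfold edgeWeight
      by_cases h1 : Even (n + 1) <;> by_cases h2 : e = 0 <;> simp [h1, h2]
      ring
    simp only [hterm, Finset.sum_add_distrib, ← Finset.sum_mul]
    simp
  rw [hsum] at h0
  by_cases heven : Even (n + 1)
  · rw [if_pos heven] at h0
    obtain ⟨m, hm⟩ := heven
    have hs0 : (s 0 : ℝ) = 1 ∨ (s 0 : ℝ) = -1 := by
      rcases hs 0 with h | h <;> simp [h]
    have hcases : ∑ e, s e = 0 ∨ 2 ≤ ∑ e, s e ∨ ∑ e, s e ≤ -2 := by omega
    rcases hcases with h | h | h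
    · rw [h] at h0
      rcases hs0 with h' | h' <;> norm_num [h'] at h0
    · have : (2 : ℝ) ≤ ((∑ e, s e : ℤ) : ℝ) := by exact_mod_cast h
      rcases hs0 with h' | h' <;> nlinarith
    · have : ((∑ e, s e : ℤ) : ℝ) ≤ -2 := by exact_mod_cast h
      rcases hs0 with h' | h' <;> nlinarith
  · rw [if_neg heven, add_zero] at h0
    rcases mul_eq_zero.1 h0 with h | h
    · have : ∑ e, s e = 0 := by exact_mod_cast h
      rw [Nat.not_even_iff_odd] at heven
      obtain ⟨m, hm⟩ := heven
      omega
    · linarith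

variable {h : TropicalLaurentPoly n}

theorem IsCycleTropical.mem_support_iff (H : IsCycleTropical h) {m : Fin n → ℤ} :
    m ∈ h.coeff.support ↔ m = 0 ∨ (∃ e, m = edgeExponent e) ∨ ∃ e, m = -edgeExponent e := by
  rw [Finsupp.mem_support_iff]
  constructor
  · intro hm
    by_contra hcon
    push Not at hcon
    exact hm (H.coeff_other m hcon.1 hcon.2.1 hcon.2.2)
  · rintro (rfl | ⟨e, rfl⟩ | ⟨e, rfl⟩) h0
    · rw [H.coeff_zero] at h0
      exact WithTop.zero_ne_top (Tropical.trop_injective h0)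
    · rw [H.coeff_edge] at h0
      exact WithTop.coe_ne_top (Tropical.trop_injective h0)
    · rw [H.coeff_neg_edge] at h0
      exact WithTop.coe_ne_top (Tropical.trop_injective h0)

theorem IsCycleTropical.termValue_zero (H : IsCycleTropical h) (p : Fin n → ℝ) :
    termValue h 0 p = 0 := by
  simp [termValue, H.coeff_zero, zero_pairing]

theorem IsCycleTropical.termValue_edge (H : IsCycleTropical h) (e : Fin (n + 1)) (p : Fin n → ℝ) :
    termValue h (edgeExponent e) p = edgeWeight n e + pairing (edgeExponent e) p := by
  simp [termValue, H.coeff_edge]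

theorem IsCycleTropical.termValue_neg_edge (H : IsCycleTropical h) (e : Fin (n + 1))
    (p : Fin n → ℝ) :
    termValue h (-edgeExponent e) p = edgeWeight n e - pairing (edgeExponent e) p := by
  simp [termValue, H.coeff_neg_edge, neg_pairing, sub_eq_add_neg]

theorem IsCycleTropical.le_termValue_iff (H : IsCycleTropical h) (p : Fin n → ℝ) (t : ℝ) :
    (∀ m ∈ h.coeff.support, t ≤ termValue h m p) ↔
      t ≤ 0 ∧ ∀ e, |pairing (edgeExponent e) p| ≤ edgeWeight n e - t := by
  constructor
  · intro ht
    refine ⟨?_, fun e => abs_le.2 ⟨?_, ?_⟩⟩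
    · rw [← H.termValue_zero p]
      exact ht _ (H.mem_support_iff.2 (Or.inl rfl))
    · have := ht _ (H.mem_support_iff.2 (Or.inr (Or.inl ⟨e, rfl⟩)))
      rw [H.termValue_edge] at this
      linarith
    · have := ht _ (H.mem_support_iff.2 (Or.inr (Or.inr ⟨e, rfl⟩)))
      rw [H.termValue_neg_edge] at this
      linarith
  · rintro ⟨h0, h1⟩ m hm
    rcases H.mem_support_iff.1 hm with rfl | ⟨e, rfl⟩ | ⟨e, rfl⟩
    · rwa [H.termValue_zero]
    · rw [H.termValue_edge]
      linarith [(abs_le.1 (h1 e)).1]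
    · rw [H.termValue_neg_edge]
      linarith [(abs_le.1 (h1 e)).2]

/-- At a vertex the constant term and one term for each tight edge are active, and their exponents
are the vertices of a unimodular simplex. -/
theorem IsCycleTropical.hasStableMultiplicity_one (H : IsCycleTropical h) {p : Fin n → ℝ}
    (hp : p ∈ cycleVertices n) : HasStableMultiplicity (fun _ : Fin n => h) p 1 := by
  obtain ⟨k, htight, hk⟩ := hp
  let s : Fin n → ℤ := fun i => if 0 < pairing (edgeExponent (k.succAbove i)) p then -1 else 1
  have hs : ∀ i, s i = 1 ∨ s i = -1 := fun i => by
    simp only [s]; split_ifs <;> simp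
  have hmin : ∀ m ∈ h.coeff.support, 0 ≤ termValue h m p := by
    rw [H.le_termValue_iff]
    refine ⟨le_rfl, fun e => ?_⟩
    rw [sub_zero]
    by_cases he : e = k
    · rw [he]; exact hk.le
    · exact (htight e he).le
  have hmem0 : (0 : Fin n → ℤ) ∈ h.coeff.support := H.mem_support_iff.2 (Or.inl rfl)
  have active_iff : ∀ m ∈ h.coeff.support, m ∈ activeExponents h p ↔ termValue h m p = 0 := by
    intro m hm
    rw [mem_activeExponents]
    constructor
    · rintro ⟨-, h1⟩
      refine le_antisymm ?_ (hmin m hm)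
      rw [← H.termValue_zero p]
      exact h1 0 hmem0
    · intro h1
      exact ⟨hm, fun m' hm' => h1 ▸ hmin m' hm'⟩
  refine _root_.hasStableMultiplicity_one (isUnit_det_edgeExponent k s hs) ?_
  ext m
  rw [Set.mem_range]
  constructor
  · intro hm
    have hsup := (mem_activeExponents.1 hm).1
    have hval := (active_iff m hsup).1 hm
    rcases H.mem_support_iff.1 hsup with rfl | ⟨e, rfl⟩ | ⟨e, rfl⟩
    · exact ⟨none, rfl⟩
    · rw [H.termValue_edge] at hval
      have hpos := edgeWeight_pos e
      have hne : e ≠ k := by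
        rintro rfl
        linarith [(abs_lt.1 hk).1]
      obtain ⟨i, rfl⟩ := Fin.exists_succAbove_eq hne
      refine ⟨some i, ?_⟩
      change s i • edgeExponent (k.succAbove i) = _
      simp only [s]
      rw [if_neg (by linarith), one_smul]
    · rw [H.termValue_neg_edge] at hval
      have hpos := edgeWeight_pos e
      have hne : e ≠ k := by
        rintro rfl
        linarith [(abs_lt.1 hk).2]
      obtain ⟨i, rfl⟩ := Fin.exists_succAbove_eq hne
      refine ⟨some i, ?_⟩
      change s i • edgeExponent (k.succAbove i) = _
      simp only [s]
      rw [if_pos (by linarith), neg_one_smul]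
  · rintro ⟨_ | i, rfl⟩
    · exact (active_iff 0 hmem0).2 (H.termValue_zero p)
    · have hi := htight _ (Fin.succAbove_ne k i)
      change s i • edgeExponent (k.succAbove i) ∈ _
      simp only [s]
      split_ifs with hsign
      · rw [neg_one_smul, active_iff _ (H.mem_support_iff.2 (Or.inr (Or.inr ⟨_, rfl⟩))),
          H.termValue_neg_edge, ← hi, abs_of_pos hsign, sub_self]
      · rw [one_smul, active_iff _ (H.mem_support_iff.2 (Or.inr (Or.inl ⟨_, rfl⟩))),
          H.termValue_edge, ← hi, abs_of_nonpos (not_lt.1 hsign), neg_add_cancel]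

/-- At any other point the differences of the active exponents do not span the whole space. Not all
edges can be active, since no signed sum of weights vanishes. If the constant term is not active,
then the active exponents lie on an affine hyperplane; if it is active, then two edges are not
active. -/
theorem IsCycleTropical.hasStableMultiplicity_zero (H : IsCycleTropical h) (hn : 0 < n)
    {p : Fin n → ℝ} (hp : p ∉ cycleVertices n) :
    HasStableMultiplicity (fun _ : Fin n => h) p 0 := by
  refine _root_.hasStableMultiplicity_zero fun P Q hP hQ => ?_
  let t : ℝ := termValue h (P ⟨0, hn⟩) p
  have hval : ∀ m ∈ activeExponents h p, termValue h m p = t := fun m hm =>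
    termValue_eq_of_active hm (hP _)
  obtain ⟨ht, hle⟩ := (H.le_termValue_iff p t).1 (mem_activeExponents.1 (hP ⟨0, hn⟩)).2
  -- It is enough to find a nonzero vector with constant pairing with the active exponents.
  have reduce : ∀ (z : Fin n → ℝ) (c : ℝ), z ≠ 0 → (∀ m ∈ activeExponents h p, pairing m z = c) →
      (Matrix.of fun j => Q j - P j).det = 0 := by
    intro z c hz hc
    refine det_eq_zero_of_pairing_eq_zero _ hz fun j => ?_
    change pairing (Q j - P j) z = 0
    rw [sub_pairing, hc _ (hQ j), hc _ (hP j), sub_self]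
  obtain ⟨k, hk⟩ : ∃ k, |pairing (edgeExponent k) p| ≠ edgeWeight n k - t := by
    by_contra! hall
    refine signed_sum_edgeWeight_ne_zero (n := n)
      (fun e => if 0 < pairing (edgeExponent e) p then 1 else -1)
      (fun e => by split_ifs <;> simp) (neg_nonneg.2 ht) ?_
    refine Eq.trans ?_ (sum_pairing_edgeExponent p)
    refine Finset.sum_congr rfl fun e _ => ?_
    rw [← sub_eq_add_neg, ← hall e]
    split_ifs with hsign
    · rw [abs_of_pos hsign]; simp
    · rw [abs_of_nonpos (not_lt.1 hsign)]; simp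
  have hne_k : ∀ e, (pairing (edgeExponent e) p = edgeWeight n e - t ∨
      pairing (edgeExponent e) p = -(edgeWeight n e - t)) → e ≠ k := by
    rintro e he rfl
    have hpos := edgeWeight_pos e
    rcases he with he | he
    · exact hk (by rw [he, abs_of_nonneg (by linarith)])
    · exact hk (by rw [he, abs_neg, abs_of_nonneg (by linarith)])
  rcases ht.lt_or_eq with hneg | hzero
  · obtain ⟨z, hz⟩ := exists_pairing_edgeExponent_eq k
      fun e => if 0 < pairing (edgeExponent e) p then -1 else 1
    have hone : ∀ m ∈ activeExponents h p, pairing m z = 1 := by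
      intro m hm
      have hm' := hval m hm
      rcases H.mem_support_iff.1 (mem_activeExponents.1 hm).1 with rfl | ⟨e, rfl⟩ | ⟨e, rfl⟩
      · rw [H.termValue_zero] at hm'
        linarith
      · rw [H.termValue_edge] at hm'
        have hpos := edgeWeight_pos e
        rw [hz e (hne_k e (Or.inr (by linarith))), if_neg (by linarith)]
      · rw [H.termValue_neg_edge] at hm'
        have hpos := edgeWeight_pos e
        rw [neg_pairing, hz e (hne_k e (Or.inl (by linarith))), if_pos (by linarith), neg_neg]
    refine reduce z 1 ?_ hone
    rintro rfl
    have := hone _ (hP ⟨0, hn⟩)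
    rw [pairing_zero] at this
    exact zero_ne_one this
  · rw [hzero] at hle hk hval hne_k
    simp only [sub_zero] at hle hk hne_k
    obtain ⟨k', hk', hk'2⟩ : ∃ e, e ≠ k ∧ |pairing (edgeExponent e) p| ≠ edgeWeight n e := by
      by_contra! hcon
      exact hp ⟨k, hcon, lt_of_le_of_ne (hle k) hk⟩
    obtain ⟨z, hz⟩ := exists_pairing_edgeExponent_eq k fun e => if e = k' then 1 else 0
    refine reduce z 0 ?_ fun m hm => ?_
    · rintro rfl
      have := hz k' hk'
      rw [pairing_zero, if_pos rfl] at this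
      exact zero_ne_one this
    · have hm' := hval m hm
      rcases H.mem_support_iff.1 (mem_activeExponents.1 hm).1 with rfl | ⟨e, rfl⟩ | ⟨e, rfl⟩
      · exact zero_pairing z
      · rw [H.termValue_edge] at hm'
        have hpos := edgeWeight_pos e
        have he : pairing (edgeExponent e) p = -edgeWeight n e := by linarith
        rw [hz e (hne_k e (Or.inr he)), if_neg]
        rintro rfl
        exact hk'2 (by rw [he, abs_neg, abs_of_pos hpos])
      · rw [H.termValue_neg_edge] at hm'
        have hpos := edgeWeight_pos e
        have he : pairing (edgeExponent e) p = edgeWeight n e := by linarith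
        rw [neg_pairing, hz e (hne_k e (Or.inl he)), if_neg, neg_zero]
        rintro rfl
        exact hk'2 (by rw [he, abs_of_pos hpos])

theorem IsCycleTropical.stableSelfIntersection_eq (H : IsCycleTropical h) (hn : 0 < n) :
    stableSelfIntersection h = cycleVertices n := by
  ext p
  constructor
  · rintro ⟨m, hm, hmult⟩
    by_contra hp
    exact hm.ne' ((H.hasStableMultiplicity_zero hn hp).eq_zero hmult)
  · exact fun hp => ⟨1, one_pos, H.hasStableMultiplicity_one hp⟩

end Vertices

/-! ### The number of vertices -/

/-- The signed sum of the weights of the edges other than `k`, with positive signs on `Q`. -/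
def signedWeight (n : ℕ) (k : Fin (n + 1)) (Q : Finset (Fin (n + 1))) : ℤ :=
  ∑ e ∈ Finset.univ.erase k, if e ∈ Q then edgeWeight n e else -edgeWeight n e

/-- The sets `Q` of edges other than `k` such that there is a vertex with slack edge `k` at which
exactly the slopes along the edges in `Q` are equal to the weights, not to their negatives. -/
def admissibleSets (n : ℕ) (k : Fin (n + 1)) : Finset (Finset (Fin (n + 1))) :=
  (Finset.univ.erase k).powerset.filter fun Q => |signedWeight n k Q| < edgeWeight n k

section Count

variable {n : ℕ}

theorem ncard_cycleVertices :
    (cycleVertices n).ncard = ∑ k : Fin (n + 1), (admissibleSets n k).card := by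
  classical
  let S : Finset (Σ _ : Fin (n + 1), Finset (Fin (n + 1))) :=
    Finset.univ.sigma fun k => admissibleSets n k
  choose f hf using fun x : Σ _ : Fin (n + 1), Finset (Fin (n + 1)) =>
    exists_pairing_edgeExponent_eq x.1 fun e =>
      if e ∈ x.2 then (edgeWeight n e : ℝ) else -edgeWeight n e
  have habs : ∀ x e, e ≠ x.1 → |pairing (edgeExponent e) (f x)| = edgeWeight n e := by
    intro x e he
    rw [hf x e he]
    split_ifs
    · exact abs_of_pos (edgeWeight_pos e)
    · rw [abs_neg, abs_of_pos (edgeWeight_pos e)]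
  have hslack : ∀ x, pairing (edgeExponent x.1) (f x) = -(signedWeight n x.1 x.2 : ℝ) := by
    intro x
    rw [pairing_edgeExponent_eq_neg_sum, neg_inj, signedWeight, Int.cast_sum]
    refine Finset.sum_congr rfl fun e he => ?_
    rw [hf x e (Finset.ne_of_mem_erase he)]
    split_ifs <;> simp
  have hlt : ∀ x ∈ S, |pairing (edgeExponent x.1) (f x)| < edgeWeight n x.1 := by
    intro x hx
    have hx' := (Finset.mem_filter.1 (Finset.mem_sigma.1 hx).2).2
    rw [hslack, abs_neg]
    exact_mod_cast hx'
  have himage : f '' (S : Set _) = cycleVertices n := by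
    ext p
    constructor
    · rintro ⟨x, hx, rfl⟩
      exact ⟨x.1, habs x, hlt x hx⟩
    · rintro ⟨k, htight, hk⟩
      let Q : Finset (Fin (n + 1)) :=
        (Finset.univ.erase k).filter fun e => 0 < pairing (edgeExponent e) p
      have heq : f ⟨k, Q⟩ = p := by
        rw [← sub_eq_zero]
        refine eq_zero_of_pairing_edgeExponent_eq_zero k fun e he => ?_
        rw [pairing_sub, hf ⟨k, Q⟩ e he, ← htight e he, sub_eq_zero]
        by_cases hpos : 0 < pairing (edgeExponent e) p
        · rw [if_pos (by simp [Q, he, hpos]), abs_of_pos hpos]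
        · rw [if_neg (by simp [Q, hpos]), abs_of_nonpos (not_lt.1 hpos), neg_neg]
      refine ⟨⟨k, Q⟩, ?_, heq⟩
      refine Finset.mem_coe.2 (Finset.mem_sigma.2 ⟨Finset.mem_univ _, Finset.mem_filter.2
        ⟨Finset.mem_powerset.2 (Finset.filter_subset _ _), ?_⟩⟩)
      have h1 := hslack ⟨k, Q⟩
      rw [heq] at h1
      rw [h1, abs_neg] at hk
      exact_mod_cast hk
  have hinj : Set.InjOn f S := by
    rintro ⟨k, Q⟩ hx ⟨k', Q'⟩ hx' heq
    have hkk : k = k' := by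
      by_contra hne
      have h1 := hlt _ hx
      rw [heq] at h1
      exact h1.ne (habs ⟨k', Q'⟩ k hne)
    subst hkk
    have hsub : ∀ {R}, (⟨k, R⟩ : Σ _ : Fin (n + 1), Finset (Fin (n + 1))) ∈ S → k ∉ R := by
      intro R hR hmem
      have := Finset.mem_powerset.1 (Finset.mem_filter.1 (Finset.mem_sigma.1 hR).2).1 hmem
      exact Finset.ne_of_mem_erase this rfl
    congr 1
    ext e
    by_cases he : e = k
    · subst he
      exact iff_of_false (hsub hx) (hsub hx')
    · have h1 := hf ⟨k, Q⟩ e he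
      rw [heq, hf ⟨k, Q'⟩ e he] at h1
      have hpos := edgeWeight_pos e
      by_cases h2 : e ∈ Q <;> by_cases h3 : e ∈ Q' <;> simp only [h2, h3, if_true, if_false] at h1 ⊢
      · linarith
      · linarith
  rw [← himage, hinj.ncard_image, Set.ncard_coe_finset, Finset.card_sigma]

theorem signedWeight_eq {k : Fin (n + 1)} {Q : Finset (Fin (n + 1))} (hQ : k ∉ Q) :
    signedWeight n k Q = 2 * (Q.card + if Even (n + 1) ∧ 0 ∈ Q then 1 else 0) -
      (n + if Even (n + 1) ∧ k ≠ 0 then 1 else 0) := by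
  have hweight : ∀ R : Finset (Fin (n + 1)), ∑ e ∈ R, edgeWeight n e =
      R.card + if Even (n + 1) ∧ 0 ∈ R then 1 else 0 := by
    intro R
    simp only [edgeWeight, Finset.sum_add_distrib]
    by_cases heven : Even (n + 1) <;> simp [heven]
  have hsub : Q ⊆ Finset.univ.erase k := fun e he =>
    Finset.mem_erase.2 ⟨fun h => hQ (h ▸ he), Finset.mem_univ e⟩
  have hsplit : signedWeight n k Q =
      2 * ∑ e ∈ Q, edgeWeight n e - ∑ e ∈ Finset.univ.erase k, edgeWeight n e := by
    rw [← Finset.inter_eq_right.2 hsub, ← Finset.sum_ite_mem, Finset.mul_sum,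
      ← Finset.sum_sub_distrib, signedWeight]
    refine Finset.sum_congr rfl fun e he => ?_
    have : e ∈ Finset.univ.erase k ∩ Q ↔ e ∈ Q := by simp [Finset.ne_of_mem_erase he]
    simp only [this]
    split_ifs <;> ring
  rw [hsplit, hweight, hweight, Finset.card_erase_of_mem (Finset.mem_univ k), Finset.card_univ,
    Fintype.card_fin, Nat.add_sub_cancel]
  simp [eq_comm]

theorem mem_admissibleSets {k : Fin (n + 1)} {Q : Finset (Fin (n + 1))} :
    Q ∈ admissibleSets n k ↔ k ∉ Q ∧ |signedWeight n k Q| < edgeWeight n k := by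
  rw [admissibleSets, Finset.mem_filter, Finset.mem_powerset, Finset.subset_erase]
  simp

/-- For an odd number of edges the admissible sets are the ones that contain half of the edges other
than `k`. -/
theorem card_admissibleSets_of_odd (hodd : ¬ Even (n + 1)) (k : Fin (n + 1)) :
    (admissibleSets n k).card = n.choose (n / 2) := by
  have hpow : admissibleSets n k = (Finset.univ.erase k).powersetCard (n / 2) := by
    ext Q
    rw [mem_admissibleSets, Finset.mem_powersetCard, Finset.subset_erase]
    simp only [Finset.subset_univ, true_and]
    refine and_congr_right fun hQ => ?_
    rw [signedWeight_eq hQ]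
    rw [Nat.not_even_iff_odd] at hodd
    simp only [edgeWeight, Nat.not_even_iff_odd.2 hodd, false_and, if_false]
    obtain ⟨m, hm⟩ := hodd
    rw [abs_lt]
    omega
  rw [hpow, Finset.card_powersetCard, Finset.card_erase_of_mem (Finset.mem_univ k),
    Finset.card_univ, Fintype.card_fin, Nat.add_sub_cancel]

/-- For an even number of edges the admissible sets `Q` correspond to the sets `P` of half of the
edges that contain both or neither of `0` and `k`, by deletion of `k` from `P`. -/
theorem card_admissibleSets_of_even {m : ℕ} (hm : n + 1 = m + m) (k : Fin (n + 1)) :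
    (admissibleSets n k).card =
      ((Finset.univ.powersetCard m).filter fun P => k ∈ P ↔ 0 ∈ P).card := by
  have heven : Even (n + 1) := ⟨m, hm⟩
  have mem_iff : ∀ Q, Q ∈ admissibleSets n k ↔ k ∉ Q ∧
      (k = 0 ∧ (Q.card = m ∨ Q.card + 1 = m) ∨
        k ≠ 0 ∧ (0 ∈ Q ∧ Q.card + 1 = m ∨ 0 ∉ Q ∧ Q.card = m)) := by
    intro Q
    rw [mem_admissibleSets]
    refine and_congr_right fun hQ => ?_
    rw [signedWeight_eq hQ, abs_lt]
    simp only [edgeWeight, heven, true_and]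
    by_cases hk : k = 0
    · subst hk
      simp only [hQ, if_true, if_false, ne_eq, not_true, true_and, false_and, or_false]
      omega
    · by_cases h0 : (0 : Fin (n + 1)) ∈ Q
      · simp only [hk, h0, if_true, if_false, ne_eq, not_true, not_false_eq_true, true_and,
          false_and, or_false, false_or]
        omega
      · simp only [hk, h0, if_true, if_false, ne_eq, not_false_eq_true, true_and,
          false_and, false_or]
        omega
  have mem_half_iff : ∀ P, P ∈ ((Finset.univ.powersetCard m).filter fun P => k ∈ P ↔ 0 ∈ P) ↔
      P.card = m ∧ (k ∈ P ↔ 0 ∈ P) := by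
    simp [Finset.mem_powersetCard]
  symm
  refine Finset.card_nbij' (fun P => P.erase k) (fun Q => if Q.card = m then Q else insert k Q)
    ?_ ?_ ?_ ?_
  · intro P hP
    rw [Finset.mem_coe, mem_half_iff] at hP
    obtain ⟨hcard, hiff⟩ := hP
    change P.erase k ∈ admissibleSets n k
    rw [mem_iff]
    refine ⟨Finset.notMem_erase k P, ?_⟩
    by_cases hkP : k ∈ P
    · have h1 := Finset.card_erase_add_one hkP
      by_cases hk : k = 0
      · exact Or.inl ⟨hk, Or.inr (h1.trans hcard)⟩
      · exact Or.inr ⟨hk, Or.inl ⟨Finset.mem_erase.2 ⟨Ne.symm hk, hiff.1 hkP⟩, h1.trans hcard⟩⟩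
    · rw [Finset.erase_eq_of_notMem hkP]
      by_cases hk : k = 0
      · exact Or.inl ⟨hk, Or.inl hcard⟩
      · exact Or.inr ⟨hk, Or.inr ⟨fun h => hkP (hiff.2 h), hcard⟩⟩
  · intro Q hQ
    rw [Finset.mem_coe, mem_iff] at hQ
    obtain ⟨hkQ, hQ⟩ := hQ
    rw [Finset.mem_coe, mem_half_iff]
    by_cases hcard : Q.card = m
    · simp only [if_pos hcard]
      refine ⟨hcard, iff_of_false hkQ fun h0 => ?_⟩
      rcases hQ with ⟨rfl, -⟩ | ⟨-, ⟨-, h⟩ | ⟨h, -⟩⟩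
      · exact hkQ h0
      · omega
      · exact h h0
    · simp only [if_neg hcard]
      rw [Finset.card_insert_of_notMem hkQ]
      rcases hQ with ⟨rfl, h⟩ | ⟨hk, ⟨h0, h⟩ | ⟨-, h⟩⟩
      · exact ⟨h.resolve_left hcard, Iff.rfl⟩
      · exact ⟨h, iff_of_true (Finset.mem_insert_self k Q) (Finset.mem_insert_of_mem h0)⟩
      · exact absurd h hcard
  · intro P hP
    rw [Finset.mem_coe, mem_half_iff] at hP
    by_cases hkP : k ∈ P
    · have h1 := Finset.card_erase_add_one hkP
      change (if (P.erase k).card = m then _ else _) = P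
      rw [if_neg (by omega), Finset.insert_erase hkP]
    · change (if (P.erase k).card = m then _ else _) = P
      have h1 := Finset.erase_eq_of_notMem hkP
      exact (if_pos (by rw [h1, hP.1])).trans h1
  · intro Q hQ
    rw [Finset.mem_coe, mem_iff] at hQ
    change (if Q.card = m then Q else insert k Q).erase k = Q
    split_ifs
    · exact Finset.erase_eq_of_notMem hQ.1
    · exact Finset.erase_insert hQ.1

/-- For an even number of edges the pairs `(k, P)` are counted for each `P` separately: half of the
edges `k` lie on the same side of `P` as `0`. -/
theorem ncard_cycleVertices_eq : (cycleVertices n).ncard = (n + 1) * n.choose (n / 2) := by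
  rw [ncard_cycleVertices]
  by_cases heven : Even (n + 1)
  · obtain ⟨m, hm⟩ := heven
    have hside : ∀ P ∈ (Finset.univ : Finset (Fin (n + 1))).powersetCard m,
        (Finset.univ.filter fun k => k ∈ P ↔ 0 ∈ P).card = m := by
      intro P hP
      have hP := (Finset.mem_powersetCard.1 hP).2
      by_cases h0 : (0 : Fin (n + 1)) ∈ P
      · simpa [h0] using hP
      · have : (Finset.univ.filter fun k => k ∈ P ↔ 0 ∈ P) = Pᶜ := by ext; simp [h0]
        rw [this, Finset.card_compl, Fintype.card_fin]
        omega
    simp only [card_admissibleSets_of_even hm, Finset.card_filter]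
    rw [Finset.sum_comm]
    simp only [← Finset.card_filter]
    rw [Finset.sum_congr rfl hside, Finset.sum_const, Finset.card_powersetCard, Finset.card_univ,
      Fintype.card_fin, smul_eq_mul]
    obtain ⟨l, rfl⟩ : ∃ l, m = l + 1 := ⟨m - 1, by omega⟩
    have hdiv : n / 2 = l := by omega
    rw [hdiv]
    exact (Nat.add_one_mul_choose_eq n l).symm
  · simp only [card_admissibleSets_of_odd heven, Finset.sum_const, Finset.card_univ,
      Fintype.card_fin, smul_eq_mul]

end Count

/-- Unmixed Kuramoto equations of the cycle `C_N`, `N = n + 1 > 2`. -/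
theorem mainTheorem5 {K : Type*} [Field K] (v : AddValuation K (WithTop ℝ)) (n : ℕ) (hn : 2 < n + 1)
    (c : Fin n → K) (a : Fin (n + 1) → Fin (n + 1) → Fin n → K)
    (hc : ∀ k, v (c k) = 0)
    (ha : ∀ i j k, (SimpleGraph.cycleGraph (n + 1)).Adj i j → v (a i j k) = cycleWeight n i j) :
    ∃ h : TropicalLaurentPoly n,
      (∀ k, tropicalize v (unmixedEquation (SimpleGraph.cycleGraph (n + 1)) c a k) = h) ∧
      (stableSelfIntersection h).ncard = (n + 1) * n.choose (n / 2) ∧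
      (∀ p ∈ stableSelfIntersection h, HasStableMultiplicity (fun _ : Fin n => h) p 1) ∧
      (∀ p ∉ stableSelfIntersection h, HasStableMultiplicity (fun _ : Fin n => h) p 0) := by
  have hn0 : 0 < n := by omega
  have H := isCycleTropical_tropicalize v hn c a hc ha
  have hS := (H ⟨0, hn0⟩).stableSelfIntersection_eq hn0
  refine ⟨_, fun k => (H k).unique (H ⟨0, hn0⟩), ?_, fun p hp => ?_, fun p hp => ?_⟩
  · rw [hS, ncard_cycleVertices_eq]
  · exact (H _).hasStableMultiplicity_one (hS ▸ hp)
  · exact (H _).hasStableMultiplicity_zero hn0 (hS ▸ hp)
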